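/- Let $k$ be a field of characteristic zero. A binary quadratic operad is an operad $\mathcal P=\mathcal T(M)/\langle R\rangle$, given with its presentation, where $M$ is an $S_2$-module (placed in arity $2$), $\mathcal T(M)$ is the free symmetric operad on $M$, and $R$ is an $S_3$-submodule of $\mathcal T(M)(3)$; it is finitely generated if $\dim M<\infty$. For $c\in\{(1,2,3),(2,3,1),(3,1,2)\}$ let $\mu\otimes_c\nu\in\mathcal T(M)(3)$ be the tree $((c_1\,c_2)\,c_3)$ with inner vertex $\mu\in M$ and root vertex $\nu\in M$; thus $\mathcal T(M)(3)=\bigoplus_c M\otimes_c M$. *Compatible operads.* Let $\Omega$ be a finite nonempty set and $M_\Omega=\bigoplus_{\omega\in\Omega}M_\omega$ the sum of copies $M_\omega=\{\mu_\omega\mid\mu\in M\}$ of $M$. For $r\in\mathcal T(M)(3)$ and $\omega,\tau\in\Omega$ let $r^{\omega\tau}\in\mathcal T(M_\Omega)(3)$ be the image of $r$ under the linear map $\mu\otimes_c\nu\mapsto\mu_\omega\otimes_c\nu_\tau$. - The linearly compatible operad is ${\rm Lin}(\mathcal P)_\Omega=\mathcal T(M_\Omega)/\langle R_{\rm L}\rangle$,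 where $R_{\rm L}$ is spanned by the quasipolarizations of the elements of $R$, i.e. by $r^{\omega\omega}$ and by $r^{\omega\tau}+r^{\tau\omega}$ for $r\in R$ and $\omega\ne\tau$ in $\Omega$. - The totally compatible operad is ${\rm Tot}(\mathcal P)_\Omega=\mathcal T(M_\Omega)/\langle R_{\rm T}\rangle$, where $R_{\rm T}$ is spanned by the matching relations $r^{\omega\tau}$ ($r\in R$, $\omega,\tau\in\Omega$) and by the differences $t^{\omega\tau}-t^{\tau\omega}$ for all $t\in\mathcal T(M)(3)$ and $\omega,\tau\in\Omega$. *Manin products.* Let $\mathcal P=\mathcal T(M)/\langle R\rangle$ and $\mathcal Q=\mathcal T(N)/\langle S\rangle$ be finitely generated binary quadratic operads. - The Manin black product is $\mathcal P\bullet\mathcal Q=\mathcal T(M\otimes N\otimes{\rm sgn}_2)/\langle \Psi(R\otimes S)\rangle$, where $\Psi$ sends $(\mu\otimes_c\mu')\otimes(\nu\otimes_c\nu')$ to $(\mu\otimes\nu)\otimes_c(\mu'\otimes\nu')$ and $(\mu\otimes_c\mu')\otimes(\nu\otimes_d\nu')$ to $0$ for $c\neq d$ (here $M\otimes N\otimes{\rm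 sgn}_2$ is identified with $M\otimes N$ as a vector space). - The Manin white product is $\mathcal P\circ\mathcal Q=\mathcal T(M\otimes N)/\langle\Phi^{-1}(R\otimes\mathcal T(N)(3)+\mathcal T(M)(3)\otimes S)\rangle$, where $\Phi:\mathcal T(M\otimes N)(3)\to\mathcal T(M)(3)\otimes\mathcal T(N)(3)$ sends $(\mu\otimes\nu)\otimes_c(\mu'\otimes\nu')$ to $(\mu\otimes_c\mu')\otimes(\nu\otimes_c\nu')$. Let ${\rm Lie}$ be the binary quadratic operad with one antisymmetric generator and the Jacobi relation $((1\,2)\,3)+((2\,3)\,1)+((3\,1)\,2)$, and ${\rm Com}$ the one with one symmetric generator and the relations $((1\,2)\,3)=((2\,3)\,1)=((3\,1)\,2)$. **Proposition.** For every finite nonempty set $\Omega$ and every finitely generated binary quadratic operad $\mathcal P$ there are isomorphisms of symmetric operads $${\rm Lin}(\mathcal P)_\Omega\cong{\rm Lin}({\rm Lie})_\Omega\bullet\mathcal P\qquad\text{and}\qquad{\rm Tot}(\mathcal P)_\Omega\cong{\rm Tot}({\rm Com})_\Omega\circ\mathcal P .$$ -/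

import Mathlib

open scoped TensorProduct

universe u v w

/-! ### Symmetric operads in `k`-modules -/

/-- A symmetric operad over `k`, with components `obj n` (`n ≥ 0`).

An element of `obj n` is thought of as an operation with inputs labelled by `Fin n`;
`relabel σ p` is `p` with the input labelled `i` renamed to `σ i`, so that the usual right action is
`p · σ = relabel σ⁻¹ p`. For `p ∈ obj m` and `q i ∈ obj (n i)`, `comp e p q` is `p` with `q i`
grafted on its input `i`, where the input `j` of `q i` gets the new label `e ⟨i, j⟩`.
The classical composition map `γ : P(m) ⊗ P(n₁) ⊗ ⋯ ⊗ P(n_m) → P(n₁ + ⋯ + n_m)` is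
`comp finSigmaFinEquiv`, and conversely `comp e` is `γ` followed by the relabelling determined
by `e`. -/
structure SymOperad (k : Type u) [CommRing k] where
  obj : ℕ → Type v
  [addCommGroup : ∀ n, AddCommGroup (obj n)]
  [module : ∀ n, Module k (obj n)]
  one : obj 1
  relabel : ∀ {n : ℕ}, Equiv.Perm (Fin n) → obj n →ₗ[k] obj n
  comp : ∀ {m : ℕ} {n : Fin m → ℕ} {N : ℕ}, ((Σ i : Fin m, Fin (n i)) ≃ Fin N) →
    (obj m →ₗ[k] MultilinearMap k (fun i : Fin m => obj (n i)) (obj N))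
  relabel_one : ∀ {n : ℕ} (p : obj n), relabel 1 p = p
  relabel_mul : ∀ {n : ℕ} (σ τ : Equiv.Perm (Fin n)) (p : obj n),
    relabel (σ * τ) p = relabel σ (relabel τ p)
  relabel_comp : ∀ {m : ℕ} {n : Fin m → ℕ} {N : ℕ} (e : (Σ i : Fin m, Fin (n i)) ≃ Fin N)
    (σ : Equiv.Perm (Fin N)) (p : obj m) (q : ∀ i, obj (n i)),
    relabel σ (comp e p q) = comp (e.trans σ) p q
  comp_relabel_right : ∀ {m : ℕ} {n : Fin m → ℕ} {N : ℕ} (e : (Σ i : Fin m, Fin (n i)) ≃ Fin N)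
    (σ : ∀ i, Equiv.Perm (Fin (n i))) (p : obj m) (q : ∀ i, obj (n i)),
    comp e p (fun i => relabel (σ i) (q i)) = comp ((Equiv.sigmaCongrRight σ).trans e) p q
  comp_relabel_left : ∀ {m : ℕ} {n : Fin m → ℕ} {N : ℕ} (e : (Σ i : Fin m, Fin (n i)) ≃ Fin N)
    (σ : Equiv.Perm (Fin m)) (p : obj m) (q : ∀ i, obj (n i)),
    comp e (relabel σ p) q =
      comp ((Equiv.sigmaCongrLeft (β := fun i => Fin (n i)) σ).trans e) p (fun i => q (σ i))
  one_comp : ∀ {n : ℕ} (q : obj n),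
    comp (Equiv.uniqueSigma (fun _ : Fin 1 => Fin n)) one (fun _ => q) = q
  comp_one : ∀ {m : ℕ} (p : obj m),
    comp (Equiv.sigmaUnique (Fin m) (fun _ => Fin 1)) p (fun _ => one) = p
  assoc : ∀ {m : ℕ} {n : Fin m → ℕ} {L : ℕ} (g : (Σ i : Fin m, Fin (n i)) ≃ Fin L)
    {l : ∀ i, Fin (n i) → ℕ} {N : Fin m → ℕ}
    (f : ∀ i, (Σ j : Fin (n i), Fin (l i j)) ≃ Fin (N i)) {K : ℕ}
    (e : (Σ i : Fin m, Fin (N i)) ≃ Fin K)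
    (p : obj m) (q : ∀ i, obj (n i)) (r : ∀ i (j : Fin (n i)), obj (l i j)),
    comp e p (fun i => comp (f i) (q i) (r i)) =
      comp (n := fun s => l (g.symm s).1 (g.symm s).2)
        ((((Equiv.sigmaCongrLeft (β := fun x : (Σ i : Fin m, Fin (n i)) => Fin (l x.1 x.2))
          g.symm).trans (Equiv.sigmaAssoc (fun i j => Fin (l i j)))).trans
          (Equiv.sigmaCongrRight f)).trans e)
        (comp g p q) (fun s => r (g.symm s).1 (g.symm s).2)

attribute [instance] SymOperad.addCommGroup SymOperad.module

namespace SymOperad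

variable {k : Type u} [CommRing k]

/-- Isomorphisms of operads: families of equivariant linear bijections that respect the identity
and the compositions. -/
structure Iso (P : SymOperad.{u, v} k) (Q : SymOperad.{u, w} k) where
  toEquiv : ∀ n : ℕ, P.obj n ≃ₗ[k] Q.obj n
  map_one : toEquiv 1 P.one = Q.one
  map_relabel : ∀ {n : ℕ} (σ : Equiv.Perm (Fin n)) (p : P.obj n),
    toEquiv n (P.relabel σ p) = Q.relabel σ (toEquiv n p)
  map_comp : ∀ {m : ℕ} {n : Fin m → ℕ} {N : ℕ} (e : (Σ i : Fin m, Fin (n i)) ≃ Fin N)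
    (p : P.obj m) (q : ∀ i, P.obj (n i)),
    toEquiv N (P.comp e p q) = Q.comp e (toEquiv m p) (fun i => toEquiv (n i) (q i))

/-- Operadic ideals. -/
structure Ideal (P : SymOperad.{u, v} k) where
  carrier : ∀ n : ℕ, Submodule k (P.obj n)
  relabel_mem : ∀ {n : ℕ} (σ : Equiv.Perm (Fin n)) {p : P.obj n},
    p ∈ carrier n → P.relabel σ p ∈ carrier n
  comp_mem_left : ∀ {m : ℕ} {n : Fin m → ℕ} {N : ℕ} (e : (Σ i : Fin m, Fin (n i)) ≃ Fin N)
    {p : P.obj m} (q : ∀ i, P.obj (n i)), p ∈ carrier m → P.comp e p q ∈ carrier N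
  comp_mem_right : ∀ {m : ℕ} {n : Fin m → ℕ} {N : ℕ} (e : (Σ i : Fin m, Fin (n i)) ≃ Fin N)
    (p : P.obj m) (q : ∀ i, P.obj (n i)) (i : Fin m), q i ∈ carrier (n i) →
    P.comp e p q ∈ carrier N

/-- The operadic ideal generated by a set of elements (of any arities): the intersection of all
ideals that contain it. -/
def idealSpan (P : SymOperad.{u, v} k) (S : Set (Σ n : ℕ, P.obj n)) : Ideal P where
  carrier n := ⨅ I ∈ {I : Ideal P | ∀ x ∈ S, x.2 ∈ I.carrier x.1}, I.carrier n
  relabel_mem σ p hp := by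
    simp only [Submodule.mem_iInf] at hp ⊢
    exact fun I hI => I.relabel_mem σ (hp I hI)
  comp_mem_left e p q hp := by
    simp only [Submodule.mem_iInf] at hp ⊢
    exact fun I hI => I.comp_mem_left e q (hp I hI)
  comp_mem_right e p q i hq := by
    simp only [Submodule.mem_iInf] at hq ⊢
    exact fun I hI => I.comp_mem_right e p q i (hq I hI)

theorem Ideal.comp_sub_comp_mem {P : SymOperad.{u, v} k} (I : Ideal P) {m : ℕ} {n : Fin m → ℕ}
    {N : ℕ} (e : (Σ i : Fin m, Fin (n i)) ≃ Fin N) (p : P.obj m) (q q' : ∀ i, P.obj (n i))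
    (h : ∀ i, q i - q' i ∈ I.carrier (n i)) :
    P.comp e p q - P.comp e p q' ∈ I.carrier N := by
  have key : ∀ s : Finset (Fin m),
      P.comp e p (s.piecewise q q') - P.comp e p q' ∈ I.carrier N := by
    intro s
    induction s using Finset.induction_on with
    | empty => simp
    | insert a s ha ih =>
      have h1 : (insert a s).piecewise q q' = Function.update (s.piecewise q q') a (q a) :=
        Finset.piecewise_insert s q q' a
      have h2 : s.piecewise q q' = Function.update (s.piecewise q q') a (q' a) := by
        rw [Function.eq_update_iff]
        simp [ha]
      have h3 : P.comp e p ((insert a s).piecewise q q') - P.comp e p (s.piecewise q q') =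
          P.comp e p (Function.update (s.piecewise q q') a (q a - q' a)) := by
        rw [MultilinearMap.map_update_sub, h1, ← h2]
      have h4 : P.comp e p (Function.update (s.piecewise q q') a (q a - q' a)) ∈ I.carrier N :=
        I.comp_mem_right e p _ a (by simpa using h a)
      have h5 := (I.carrier N).add_mem (h3 ▸ h4) ih
      simpa using h5
  simpa using key Finset.univ

/-- The composition of the quotient operad. -/
noncomputable def quotientComp (P : SymOperad.{u, v} k) (I : Ideal P) {m : ℕ} {n : Fin m → ℕ}
    {N : ℕ} (e : (Σ i : Fin m, Fin (n i)) ≃ Fin N) :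
    (P.obj m ⧸ I.carrier m) →ₗ[k]
      MultilinearMap k (fun i : Fin m => P.obj (n i) ⧸ I.carrier (n i)) (P.obj N ⧸ I.carrier N) :=
  (I.carrier m).liftQ
    { toFun := fun p =>
        { toFun := fun q => (I.carrier N).mkQ (P.comp e p (fun i => (q i).out))
          map_update_add' := by
            intro _ q i x y
            rw [← map_add, ← sub_eq_zero, ← map_sub, Submodule.mkQ_apply,
              Submodule.Quotient.mk_eq_zero]
            have h : ∀ z, (fun j => (Function.update q i z j).out) =
                Function.update (fun j => (q j).out) i z.out := by
              intro z
              ext j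
              by_cases hj : j = i
              · subst hj; simp
              · simp [hj]
            rw [h x, h y, ← MultilinearMap.map_update_add]
            apply I.comp_sub_comp_mem
            intro j
            rw [← Submodule.Quotient.eq]
            by_cases hj : j = i
            · subst hj; simp [Submodule.Quotient.mk_out]
            · simp [hj]
          map_update_smul' := by
            intro _ q i c x
            rw [← map_smul, ← sub_eq_zero, ← map_sub, Submodule.mkQ_apply,
              Submodule.Quotient.mk_eq_zero]
            have h : (fun j => (Function.update q i x j).out) =
                Function.update (fun j => (q j).out) i x.out := by
              ext j
              by_cases hj : j = i
              · subst hj; simp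
              · simp [hj]
            rw [h, ← MultilinearMap.map_update_smul]
            apply I.comp_sub_comp_mem
            intro j
            rw [← Submodule.Quotient.eq]
            by_cases hj : j = i
            · subst hj; simp [Submodule.Quotient.mk_out]
            · simp [hj] }
      map_add' := by
        intro p p'
        ext q
        simp
      map_smul' := by
        intro c p
        ext q
        simp }
    (by
      intro p hp
      rw [LinearMap.mem_ker]
      ext q
      simpa using I.comp_mem_left e (fun i => (q i).out) hp)

theorem quotientComp_mk (P : SymOperad.{u, v} k) (I : Ideal P) {m : ℕ} {n : Fin m → ℕ}
    {N : ℕ} (e : (Σ i : Fin m, Fin (n i)) ≃ Fin N) (p : P.obj m) (q : ∀ i, P.obj (n i)) :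
    P.quotientComp I e ((I.carrier m).mkQ p) (fun i => (I.carrier (n i)).mkQ (q i)) =
      (I.carrier N).mkQ (P.comp e p q) := by
  change (I.carrier N).mkQ (P.comp e p (fun i => ((I.carrier (n i)).mkQ (q i)).out)) = _
  rw [← sub_eq_zero, ← map_sub, Submodule.mkQ_apply, Submodule.Quotient.mk_eq_zero]
  apply I.comp_sub_comp_mem
  intro i
  rw [← Submodule.Quotient.eq]
  simp [Submodule.Quotient.mk_out]

/-- The quotient of an operad by an operadic ideal. -/
noncomputable def quotient (P : SymOperad.{u, v} k) (I : Ideal P) : SymOperad.{u, v} k where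
  obj n := P.obj n ⧸ I.carrier n
  one := (I.carrier 1).mkQ P.one
  relabel {n} σ := (I.carrier n).mapQ (I.carrier n) (P.relabel σ) (fun _ hp => I.relabel_mem σ hp)
  comp e := P.quotientComp I e
  relabel_one p := by
    obtain ⟨p, rfl⟩ := Submodule.mkQ_surjective _ p
    simp [P.relabel_one]
  relabel_mul σ τ p := by
    obtain ⟨p, rfl⟩ := Submodule.mkQ_surjective _ p
    simp [P.relabel_mul]
  relabel_comp e σ p q := by
    obtain ⟨p, rfl⟩ := Submodule.mkQ_surjective _ p
    choose q' hq using fun i => Submodule.mkQ_surjective _ (q i)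
    obtain rfl : (fun i => (I.carrier _).mkQ (q' i)) = q := funext hq
    simp only [quotientComp_mk, ← P.relabel_comp]
    simp
  comp_relabel_right e σ p q := by
    obtain ⟨p, rfl⟩ := Submodule.mkQ_surjective _ p
    choose q' hq using fun i => Submodule.mkQ_surjective _ (q i)
    obtain rfl : (fun i => (I.carrier _).mkQ (q' i)) = q := funext hq
    have h : (fun i => (I.carrier _).mapQ (I.carrier _) (P.relabel (σ i))
        (fun _ hp => I.relabel_mem (σ i) hp) ((I.carrier _).mkQ (q' i))) =
        fun i => (I.carrier _).mkQ (P.relabel (σ i) (q' i)) := by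
      ext i; simp
    rw [h, quotientComp_mk, quotientComp_mk, P.comp_relabel_right]
  comp_relabel_left e σ p q := by
    obtain ⟨p, rfl⟩ := Submodule.mkQ_surjective _ p
    choose q' hq using fun i => Submodule.mkQ_surjective _ (q i)
    obtain rfl : (fun i => (I.carrier _).mkQ (q' i)) = q := funext hq
    have h : (I.carrier _).mapQ (I.carrier _) (P.relabel σ)
        (fun _ hp => I.relabel_mem σ hp) ((I.carrier _).mkQ p) =
        (I.carrier _).mkQ (P.relabel σ p) := by simp
    rw [h, quotientComp_mk, P.comp_relabel_left]
    exact (quotientComp_mk P I _ p (fun i => q' (σ i))).symm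
  one_comp q := by
    obtain ⟨q, rfl⟩ := Submodule.mkQ_surjective _ q
    rw [quotientComp_mk P I (Equiv.uniqueSigma _) P.one (fun _ => q), P.one_comp]
  comp_one p := by
    obtain ⟨p, rfl⟩ := Submodule.mkQ_surjective _ p
    rw [quotientComp_mk P I (Equiv.sigmaUnique _ _) p (fun _ => P.one), P.comp_one]
  assoc {m n L} g {l N} f {K} e p q r := by
    obtain ⟨p, rfl⟩ := Submodule.mkQ_surjective _ p
    choose q' hq using fun i => Submodule.mkQ_surjective _ (q i)
    obtain rfl : (fun i => (I.carrier _).mkQ (q' i)) = q := funext hq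
    choose r' hr using fun i j => Submodule.mkQ_surjective _ (r i j)
    obtain rfl : (fun i j => (I.carrier _).mkQ (r' i j)) = r :=
      funext fun i => funext fun j => hr i j
    simp only [quotientComp_mk]
    rw [P.assoc g f e p q' r']

end SymOperad

/-! ### The free operad on an `S`-module concentrated in arity two

An `S₂`-module is given as a representation of `Equiv.Perm (Fin 2)`; since every element of this
group is its own inverse, left and right actions coincide. -/

namespace FreeOperad

variable {k : Type u} [CommRing k] {M : Type v} [AddCommGroup M] [Module k M]

variable (k M) in
/-- Formal expressions built from generating binary operations by the operations of an operad. -/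
inductive Pre : ℕ → Type (max u v)
  | gen (x : M) : Pre 2
  | one : Pre 1
  | relabel {n : ℕ} (σ : Equiv.Perm (Fin n)) (p : Pre n) : Pre n
  | comp {m : ℕ} {n : Fin m → ℕ} {N : ℕ} (e : (Σ i : Fin m, Fin (n i)) ≃ Fin N) (p : Pre m)
      (q : ∀ i, Pre (n i)) : Pre N
  | zero {n : ℕ} : Pre n
  | add {n : ℕ} (p p' : Pre n) : Pre n
  | smul {n : ℕ} (a : k) (p : Pre n) : Pre n

open Pre in
/-- The smallest congruence on formal expressions that makes them an operad in `k`-modules in which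
`x ↦ gen x` is linear and equivariant. -/
inductive Rel (ρ : Representation k (Equiv.Perm (Fin 2)) M) :
    ∀ {n : ℕ}, Pre k M n → Pre k M n → Prop
  -- an equivalence relation compatible with all operations
  | refl {n : ℕ} (p : Pre k M n) : Rel ρ p p
  | symm {n : ℕ} {p p' : Pre k M n} : Rel ρ p p' → Rel ρ p' p
  | trans {n : ℕ} {p p' p'' : Pre k M n} : Rel ρ p p' → Rel ρ p' p'' → Rel ρ p p''
  | relabel_congr {n : ℕ} (σ : Equiv.Perm (Fin n)) {p p' : Pre k M n} : Rel ρ p p' →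
      Rel ρ (relabel σ p) (relabel σ p')
  | comp_congr {m : ℕ} {n : Fin m → ℕ} {N : ℕ} (e : (Σ i : Fin m, Fin (n i)) ≃ Fin N)
      {p p' : Pre k M m} {q q' : ∀ i, Pre k M (n i)} : Rel ρ p p' → (∀ i, Rel ρ (q i) (q' i)) →
      Rel ρ (comp e p q) (comp e p' q')
  | add_congr {n : ℕ} {p p' r r' : Pre k M n} : Rel ρ p p' → Rel ρ r r' →
      Rel ρ (add p r) (add p' r')
  | smul_congr {n : ℕ} (a : k) {p p' : Pre k M n} : Rel ρ p p' → Rel ρ (smul a p) (smul a p')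
  -- every component is a `k`-module
  | add_assoc {n : ℕ} (p q r : Pre k M n) : Rel ρ (add (add p q) r) (add p (add q r))
  | add_comm {n : ℕ} (p q : Pre k M n) : Rel ρ (add p q) (add q p)
  | zero_add {n : ℕ} (p : Pre k M n) : Rel ρ (add zero p) p
  | neg_add {n : ℕ} (p : Pre k M n) : Rel ρ (add (smul (-1) p) p) zero
  | smul_add {n : ℕ} (a : k) (p q : Pre k M n) :
      Rel ρ (smul a (add p q)) (add (smul a p) (smul a q))
  | add_smul {n : ℕ} (a b : k) (p : Pre k M n) :
      Rel ρ (smul (a + b) p) (add (smul a p) (smul b p))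
  | mul_smul {n : ℕ} (a b : k) (p : Pre k M n) : Rel ρ (smul (a * b) p) (smul a (smul b p))
  | one_smul {n : ℕ} (p : Pre k M n) : Rel ρ (smul 1 p) p
  -- the operations are linear in each argument
  | relabel_add {n : ℕ} (σ : Equiv.Perm (Fin n)) (p p' : Pre k M n) :
      Rel ρ (relabel σ (add p p')) (add (relabel σ p) (relabel σ p'))
  | relabel_smul {n : ℕ} (σ : Equiv.Perm (Fin n)) (a : k) (p : Pre k M n) :
      Rel ρ (relabel σ (smul a p)) (smul a (relabel σ p))
  | comp_add_left {m : ℕ} {n : Fin m → ℕ} {N : ℕ} (e : (Σ i : Fin m, Fin (n i)) ≃ Fin N)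
      (p p' : Pre k M m) (q : ∀ i, Pre k M (n i)) :
      Rel ρ (comp e (add p p') q) (add (comp e p q) (comp e p' q))
  | comp_smul_left {m : ℕ} {n : Fin m → ℕ} {N : ℕ} (e : (Σ i : Fin m, Fin (n i)) ≃ Fin N)
      (a : k) (p : Pre k M m) (q : ∀ i, Pre k M (n i)) :
      Rel ρ (comp e (smul a p) q) (smul a (comp e p q))
  | comp_add_right {m : ℕ} {n : Fin m → ℕ} {N : ℕ} (e : (Σ i : Fin m, Fin (n i)) ≃ Fin N)
      (p : Pre k M m) (q : ∀ i, Pre k M (n i)) (i : Fin m) (x y : Pre k M (n i)) :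
      Rel ρ (comp e p (Function.update q i (add x y)))
        (add (comp e p (Function.update q i x)) (comp e p (Function.update q i y)))
  | comp_smul_right {m : ℕ} {n : Fin m → ℕ} {N : ℕ} (e : (Σ i : Fin m, Fin (n i)) ≃ Fin N)
      (p : Pre k M m) (q : ∀ i, Pre k M (n i)) (i : Fin m) (a : k) (x : Pre k M (n i)) :
      Rel ρ (comp e p (Function.update q i (smul a x)))
        (smul a (comp e p (Function.update q i x)))
  -- the axioms of an operad
  | relabel_one {n : ℕ} (p : Pre k M n) : Rel ρ (relabel 1 p) p
  | relabel_mul {n : ℕ} (σ τ : Equiv.Perm (Fin n)) (p : Pre k M n) :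
      Rel ρ (relabel (σ * τ) p) (relabel σ (relabel τ p))
  | relabel_comp {m : ℕ} {n : Fin m → ℕ} {N : ℕ} (e : (Σ i : Fin m, Fin (n i)) ≃ Fin N)
      (σ : Equiv.Perm (Fin N)) (p : Pre k M m) (q : ∀ i, Pre k M (n i)) :
      Rel ρ (relabel σ (comp e p q)) (comp (e.trans σ) p q)
  | comp_relabel_right {m : ℕ} {n : Fin m → ℕ} {N : ℕ} (e : (Σ i : Fin m, Fin (n i)) ≃ Fin N)
      (σ : ∀ i, Equiv.Perm (Fin (n i))) (p : Pre k M m) (q : ∀ i, Pre k M (n i)) :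
      Rel ρ (comp e p (fun i => relabel (σ i) (q i)))
        (comp ((Equiv.sigmaCongrRight σ).trans e) p q)
  | comp_relabel_left {m : ℕ} {n : Fin m → ℕ} {N : ℕ} (e : (Σ i : Fin m, Fin (n i)) ≃ Fin N)
      (σ : Equiv.Perm (Fin m)) (p : Pre k M m) (q : ∀ i, Pre k M (n i)) :
      Rel ρ (comp e (relabel σ p) q)
        (comp ((Equiv.sigmaCongrLeft (β := fun i => Fin (n i)) σ).trans e) p (fun i => q (σ i)))
  | one_comp {n : ℕ} (q : Pre k M n) :
      Rel ρ (comp (Equiv.uniqueSigma (fun _ : Fin 1 => Fin n)) one (fun _ => q)) q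
  | comp_one {m : ℕ} (p : Pre k M m) :
      Rel ρ (comp (Equiv.sigmaUnique (Fin m) (fun _ => Fin 1)) p (fun _ => one)) p
  | assoc {m : ℕ} {n : Fin m → ℕ} {L : ℕ} (g : (Σ i : Fin m, Fin (n i)) ≃ Fin L)
      {l : ∀ i, Fin (n i) → ℕ} {N : Fin m → ℕ}
      (f : ∀ i, (Σ j : Fin (n i), Fin (l i j)) ≃ Fin (N i)) {K : ℕ}
      (e : (Σ i : Fin m, Fin (N i)) ≃ Fin K)
      (p : Pre k M m) (q : ∀ i, Pre k M (n i)) (r : ∀ i (j : Fin (n i)), Pre k M (l i j)) :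
      Rel ρ (comp e p (fun i => comp (f i) (q i) (r i)))
        (comp (n := fun s => l (g.symm s).1 (g.symm s).2)
          ((((Equiv.sigmaCongrLeft (β := fun x : (Σ i : Fin m, Fin (n i)) => Fin (l x.1 x.2))
            g.symm).trans (Equiv.sigmaAssoc (fun i j => Fin (l i j)))).trans
            (Equiv.sigmaCongrRight f)).trans e)
          (comp g p q) (fun s => r (g.symm s).1 (g.symm s).2))
  -- the generators form a copy of the given `S₂`-module
  | gen_add (x y : M) : Rel ρ (gen (x + y)) (add (gen x) (gen y))
  | gen_smul (a : k) (x : M) : Rel ρ (gen (a • x)) (smul a (gen x))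
  | gen_relabel (σ : Equiv.Perm (Fin 2)) (x : M) : Rel ρ (gen (ρ σ x)) (relabel σ (gen x))

variable (ρ : Representation k (Equiv.Perm (Fin 2)) M)

/-- Formal expressions of arity `n` up to `Rel`. -/
def setoid (n : ℕ) : Setoid (Pre k M n) where
  r := Rel ρ
  iseqv := ⟨Rel.refl, Rel.symm, Rel.trans⟩

/-- The component of arity `n` of the free operad. -/
def Obj (n : ℕ) : Type (max u v) := Quotient (setoid ρ n)

/-- The class of a formal expression. -/
def mk {n : ℕ} (p : Pre k M n) : Obj ρ n := Quotient.mk (setoid ρ n) p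

variable {ρ}

theorem mk_eq {n : ℕ} {p p' : Pre k M n} (h : Rel ρ p p') : mk ρ p = mk ρ p' :=
  Quotient.sound (s := setoid ρ n) h

theorem mk_surj {n : ℕ} (x : Obj ρ n) : ∃ p, mk ρ p = x :=
  Quotient.exists_rep x

/-- A chosen representative. -/
noncomputable def rep {n : ℕ} (x : Obj ρ n) : Pre k M n := (mk_surj x).choose

theorem mk_rep {n : ℕ} (x : Obj ρ n) : mk ρ (rep x) = x := (mk_surj x).choose_spec

theorem rel_rep {n : ℕ} (p : Pre k M n) : Rel ρ (rep (mk ρ p)) p :=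
  Quotient.exact (s := setoid ρ n) (mk_rep (mk ρ p))

instance (n : ℕ) : Add (Obj ρ n) where
  add x y := Quotient.map₂ (sa := setoid ρ n) (sb := setoid ρ n) (sc := setoid ρ n) Pre.add
    (fun _ _ h _ _ h' => Rel.add_congr h h') x y

instance (n : ℕ) : Zero (Obj ρ n) where
  zero := mk ρ Pre.zero

instance (n : ℕ) : Neg (Obj ρ n) where
  neg x := Quotient.map (sa := setoid ρ n) (sb := setoid ρ n) (Pre.smul (-1))
    (fun _ _ h => Rel.smul_congr _ h) x

instance (n : ℕ) : AddCommGroup (Obj ρ n) where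
  add_assoc x y z := by
    obtain ⟨x, rfl⟩ := mk_surj x
    obtain ⟨y, rfl⟩ := mk_surj y
    obtain ⟨z, rfl⟩ := mk_surj z
    exact mk_eq (Rel.add_assoc x y z)
  add_comm x y := by
    obtain ⟨x, rfl⟩ := mk_surj x
    obtain ⟨y, rfl⟩ := mk_surj y
    exact mk_eq (Rel.add_comm x y)
  zero_add x := by
    obtain ⟨x, rfl⟩ := mk_surj x
    exact mk_eq (Rel.zero_add x)
  add_zero x := by
    obtain ⟨x, rfl⟩ := mk_surj x
    exact mk_eq ((Rel.add_comm x _).trans (Rel.zero_add x))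
  neg_add_cancel x := by
    obtain ⟨x, rfl⟩ := mk_surj x
    exact mk_eq (Rel.neg_add x)
  nsmul := nsmulRec
  zsmul := zsmulRec

theorem mk_add {n : ℕ} (p q : Pre k M n) : mk ρ (p.add q) = mk ρ p + mk ρ q := rfl

instance (n : ℕ) : SMul k (Obj ρ n) where
  smul a x := Quotient.map (sa := setoid ρ n) (sb := setoid ρ n) (Pre.smul a)
    (fun _ _ h => Rel.smul_congr _ h) x

theorem mk_smul {n : ℕ} (a : k) (p : Pre k M n) : mk ρ (p.smul a) = a • mk ρ p := rfl

instance (n : ℕ) : Module k (Obj ρ n) :=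
  Module.ofMinimalAxioms
    (fun a x y => by
      obtain ⟨x, rfl⟩ := mk_surj x
      obtain ⟨y, rfl⟩ := mk_surj y
      exact mk_eq (Rel.smul_add a x y))
    (fun a b x => by
      obtain ⟨x, rfl⟩ := mk_surj x
      exact mk_eq (Rel.add_smul a b x))
    (fun a b x => by
      obtain ⟨x, rfl⟩ := mk_surj x
      exact mk_eq (Rel.mul_smul a b x))
    (fun x => by
      obtain ⟨x, rfl⟩ := mk_surj x
      exact mk_eq (Rel.one_smul x))

variable (ρ) in
/-- Renaming of inputs in the free operad. -/
noncomputable def objRelabel {n : ℕ} (σ : Equiv.Perm (Fin n)) : Obj ρ n →ₗ[k] Obj ρ n where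
  toFun x := Quotient.map (sa := setoid ρ n) (sb := setoid ρ n) (Pre.relabel σ)
    (fun _ _ h => Rel.relabel_congr _ h) x
  map_add' x y := by
    obtain ⟨x, rfl⟩ := mk_surj x
    obtain ⟨y, rfl⟩ := mk_surj y
    exact mk_eq (Rel.relabel_add σ x y)
  map_smul' a x := by
    obtain ⟨x, rfl⟩ := mk_surj x
    exact mk_eq (Rel.relabel_smul σ a x)

theorem objRelabel_mk {n : ℕ} (σ : Equiv.Perm (Fin n)) (p : Pre k M n) :
    objRelabel ρ σ (mk ρ p) = mk ρ (p.relabel σ) := rfl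

variable (ρ) in
/-- Composition in the free operad. -/
noncomputable def objComp {m : ℕ} {n : Fin m → ℕ} {N : ℕ}
    (e : (Σ i : Fin m, Fin (n i)) ≃ Fin N) :
    Obj ρ m →ₗ[k] MultilinearMap k (fun i : Fin m => Obj ρ (n i)) (Obj ρ N) where
  toFun x :=
    { toFun := fun y => mk ρ (Pre.comp e (rep x) (fun i => rep (y i)))
      map_update_add' := by
        intro inst y i a b
        obtain rfl : inst = instDecidableEqFin m := Subsingleton.elim _ _
        have h : ∀ z : Obj ρ (n i), (fun j => rep (Function.update y i z j)) =
            Function.update (fun j => rep (y j)) i (rep z) := by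
          intro z
          ext j
          by_cases hj : j = i
          · subst hj; simp
          · simp [hj]
        rw [h, h, h, ← mk_add]
        refine mk_eq (Rel.trans (Rel.comp_congr e (Rel.refl _) fun j => ?_)
          (Rel.comp_add_right e _ _ i _ _))
        by_cases hj : j = i
        · subst hj
          simp only [Function.update_self]
          refine Quotient.exact (s := setoid ρ _) ?_
          change mk ρ _ = mk ρ _
          rw [mk_add, mk_rep, mk_rep, mk_rep]
        · simp only [Function.update_of_ne hj]
          exact Rel.refl _
      map_update_smul' := by
        intro inst y i c a
        obtain rfl : inst = instDecidableEqFin m := Subsingleton.elim _ _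
        have h : ∀ z : Obj ρ (n i), (fun j => rep (Function.update y i z j)) =
            Function.update (fun j => rep (y j)) i (rep z) := by
          intro z
          ext j
          by_cases hj : j = i
          · subst hj; simp
          · simp [hj]
        rw [h, h, ← mk_smul]
        refine mk_eq (Rel.trans (Rel.comp_congr e (Rel.refl _) fun j => ?_)
          (Rel.comp_smul_right e _ _ i _ _))
        by_cases hj : j = i
        · subst hj
          simp only [Function.update_self]
          refine Quotient.exact (s := setoid ρ _) ?_
          change mk ρ _ = mk ρ _
          rw [mk_smul, mk_rep, mk_rep]
        · simp only [Function.update_of_ne hj]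
          exact Rel.refl _ }
  map_add' x x' := by
    ext y
    refine mk_eq (Rel.trans (Rel.comp_congr e ?_ fun _ => Rel.refl _)
      (Rel.comp_add_left e (rep x) (rep x') _))
    refine Quotient.exact (s := setoid ρ _) ?_
    change mk ρ _ = mk ρ _
    rw [mk_add, mk_rep, mk_rep, mk_rep]
  map_smul' c x := by
    ext y
    refine mk_eq (Rel.trans (Rel.comp_congr e ?_ fun _ => Rel.refl _)
      (Rel.comp_smul_left e c (rep x) _))
    refine Quotient.exact (s := setoid ρ _) ?_
    change mk ρ _ = mk ρ _
    rw [mk_smul, mk_rep, mk_rep]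

theorem objComp_mk {m : ℕ} {n : Fin m → ℕ} {N : ℕ} (e : (Σ i : Fin m, Fin (n i)) ≃ Fin N)
    (p : Pre k M m) (q : ∀ i, Pre k M (n i)) :
    objComp ρ e (mk ρ p) (fun i => mk ρ (q i)) = mk ρ (Pre.comp e p q) :=
  mk_eq (Rel.comp_congr e (rel_rep p) fun i => rel_rep (q i))

end FreeOperad

/-- The free operad `T(M)` on the `S`-module that is the `S₂`-module `M` in arity two and zero in
all other arities. -/
noncomputable def freeOperad {k : Type u} [CommRing k] {M : Type v} [AddCommGroup M] [Module k M]
    (ρ : Representation k (Equiv.Perm (Fin 2)) M) : SymOperad.{u, max u v} k where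
  obj n := FreeOperad.Obj ρ n
  one := FreeOperad.mk ρ FreeOperad.Pre.one
  relabel σ := FreeOperad.objRelabel ρ σ
  comp e := FreeOperad.objComp ρ e
  relabel_one p := by
    obtain ⟨p, rfl⟩ := FreeOperad.mk_surj p
    exact FreeOperad.mk_eq (FreeOperad.Rel.relabel_one p)
  relabel_mul σ τ p := by
    obtain ⟨p, rfl⟩ := FreeOperad.mk_surj p
    exact FreeOperad.mk_eq (FreeOperad.Rel.relabel_mul σ τ p)
  relabel_comp e σ p q := by
    obtain ⟨p, rfl⟩ := FreeOperad.mk_surj p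
    choose q' hq using fun i => FreeOperad.mk_surj (q i)
    obtain rfl : (fun i => FreeOperad.mk ρ (q' i)) = q := funext hq
    simp only [FreeOperad.objComp_mk, FreeOperad.objRelabel_mk]
    exact FreeOperad.mk_eq (FreeOperad.Rel.relabel_comp e σ p q')
  comp_relabel_right e σ p q := by
    obtain ⟨p, rfl⟩ := FreeOperad.mk_surj p
    choose q' hq using fun i => FreeOperad.mk_surj (q i)
    obtain rfl : (fun i => FreeOperad.mk ρ (q' i)) = q := funext hq
    simp only [FreeOperad.objComp_mk, FreeOperad.objRelabel_mk]
    exact FreeOperad.mk_eq (FreeOperad.Rel.comp_relabel_right e σ p q')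
  comp_relabel_left e σ p q := by
    obtain ⟨p, rfl⟩ := FreeOperad.mk_surj p
    choose q' hq using fun i => FreeOperad.mk_surj (q i)
    obtain rfl : (fun i => FreeOperad.mk ρ (q' i)) = q := funext hq
    rw [FreeOperad.objRelabel_mk, FreeOperad.objComp_mk]
    exact (FreeOperad.mk_eq (FreeOperad.Rel.comp_relabel_left e σ p q')).trans
      (FreeOperad.objComp_mk _ p (fun i => q' (σ i))).symm
  one_comp q := by
    obtain ⟨q, rfl⟩ := FreeOperad.mk_surj q
    exact (FreeOperad.objComp_mk (Equiv.uniqueSigma _) FreeOperad.Pre.one (fun _ => q)).trans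
      (FreeOperad.mk_eq (FreeOperad.Rel.one_comp q))
  comp_one p := by
    obtain ⟨p, rfl⟩ := FreeOperad.mk_surj p
    exact (FreeOperad.objComp_mk (Equiv.sigmaUnique _ _) p (fun _ => FreeOperad.Pre.one)).trans
      (FreeOperad.mk_eq (FreeOperad.Rel.comp_one p))
  assoc {m n L} g {l N} f {K} e p q r := by
    obtain ⟨p, rfl⟩ := FreeOperad.mk_surj p
    choose q' hq using fun i => FreeOperad.mk_surj (q i)
    obtain rfl : (fun i => FreeOperad.mk ρ (q' i)) = q := funext hq
    choose r' hr using fun i j => FreeOperad.mk_surj (r i j)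
    obtain rfl : (fun i j => FreeOperad.mk ρ (r' i j)) = r :=
      funext fun i => funext fun j => hr i j
    simp only [FreeOperad.objComp_mk]
    exact FreeOperad.mk_eq (FreeOperad.Rel.assoc g f e p q' r')

/-- The inclusion `M = T(M)(2) → T(M)` of the generators. -/
noncomputable def freeOperadGen {k : Type u} [CommRing k] {M : Type v} [AddCommGroup M] [Module k M]
    (ρ : Representation k (Equiv.Perm (Fin 2)) M) : M →ₗ[k] (freeOperad ρ).obj 2 where
  toFun x := FreeOperad.mk ρ (FreeOperad.Pre.gen x)
  map_add' x y := FreeOperad.mk_eq (FreeOperad.Rel.gen_add x y)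
  map_smul' a x := FreeOperad.mk_eq (FreeOperad.Rel.gen_smul a x)

/-! ### Quadratic elements: the `S₃`-module `T(M)(3)` -/

namespace SymOperad

variable {k : Type u} [CommRing k]

/-- The labelling `(0, 0) ↦ 0, (0, 1) ↦ 1, (1, 0) ↦ 2` of the leaves of the tree `((0 1) 2)`. -/
def combEquiv : (Σ i : Fin 2, Fin ((![2, 1] : Fin 2 → ℕ) i)) ≃ Fin 3 :=
  finSigmaFinEquiv.trans (finCongr (by simp))

/-- The family `(q, id)`. -/
def withOne (P : SymOperad.{u, v} k) (q : P.obj 2) :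
    ∀ i : Fin 2, P.obj ((![2, 1] : Fin 2 → ℕ) i)
  | 0 => q
  | 1 => P.one

theorem withOne_eq_update (P : SymOperad.{u, v} k) (q q' : P.obj 2) :
    P.withOne q = Function.update (P.withOne q') 0 q := by
  funext i
  fin_cases i
  · exact (Function.update_self (β := fun i => P.obj ((![2, 1] : Fin 2 → ℕ) i)) 0 q _).symm
  · exact (Function.update_of_ne (β := fun i => P.obj ((![2, 1] : Fin 2 → ℕ) i))
      (a := 1) (a' := 0) (by decide) q _).symm

/-- The partial composition `q ⊗ p ↦ p ∘₁ q = γ(p; q, id)` of binary operations: `q` at the inner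
vertex and `p` at the root of the tree `((1 2) 3)`. -/
noncomputable def graft (P : SymOperad.{u, v} k) : P.obj 2 ⊗[k] P.obj 2 →ₗ[k] P.obj 3 :=
  TensorProduct.lift (LinearMap.mk₂ k (fun q p => P.comp combEquiv p (P.withOne q))
    (fun q q' p => by
      rw [P.withOne_eq_update (q + q') 0, P.withOne_eq_update q 0, P.withOne_eq_update q' 0]
      exact (P.comp combEquiv p).map_update_add _ 0 q q')
    (fun a q p => by
      rw [P.withOne_eq_update (a • q) 0, P.withOne_eq_update q 0]
      exact (P.comp combEquiv p).map_update_smul _ 0 a q)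
    (fun q p p' => by simp)
    (fun a q p => by simp))

end SymOperad

/-- Coordinates on `T(M)(3) = T(M)⁽²⁾`, which is the direct sum of three copies of `M ⊗ M`: the copy
with index `c = 0, 1, 2` is spanned by the trees `((a b) d)` with leaves labelled
`(a, b, d) = (1, 2, 3), (2, 3, 1), (3, 1, 2)`, respectively, where `μ ⊗ ν` stands for the tree with
inner vertex `μ` and root vertex `ν`. -/
abbrev Quad (k : Type u) [CommRing k] (M : Type v) [AddCommGroup M] [Module k M] :=
  Fin 3 → M ⊗[k] M

namespace Quad

variable {k : Type u} [CommRing k] {M : Type v} [AddCommGroup M] [Module k M]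
  {N : Type w} [AddCommGroup N] [Module k N]

/-- The action of the cycle `(1 2 3)` on `T(M)(3)`. -/
def rotate : Quad k M →ₗ[k] Quad k M := LinearMap.funLeft k (M ⊗[k] M) (fun c : Fin 3 => c - 1)

/-- The action of the transposition `(1 2)` on `T(M)(3)`: it turns the tree `((1 2) 3)` into
`((2 1) 3)`, and exchanges the trees `((2 3) 1)`, `((1 3) 2)`, where `((b a) d)` with inner vertex
`μ` is `((a b) d)` with inner vertex `μ · (1 2)`. -/
noncomputable def transpose (ρ : Representation k (Equiv.Perm (Fin 2)) M) :
    Quad k M →ₗ[k] Quad k M :=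
  LinearMap.pi fun c : Fin 3 =>
    TensorProduct.map (ρ (Equiv.swap 0 1)) LinearMap.id ∘ₗ LinearMap.proj (-c)

/-- The element of the free operad with the given coordinates. -/
noncomputable def toFree (ρ : Representation k (Equiv.Perm (Fin 2)) M) :
    Quad k M →ₗ[k] (freeOperad ρ).obj 3 :=
  ∑ c : Fin 3, (freeOperad ρ).relabel (finRotate 3 ^ (c : ℕ)) ∘ₗ (freeOperad ρ).graft ∘ₗ
    TensorProduct.map (freeOperadGen ρ) (freeOperadGen ρ) ∘ₗ LinearMap.proj c

end Quad

/-! ### Binary quadratic operads -/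

/-- A binary quadratic presentation: an `S₂`-module `M` of generators, and an `S₃`-submodule `R` of
`T(M)(3)` of relations. -/
structure BinQuad (k : Type u) [CommRing k] where
  M : Type v
  [addCommGroup : AddCommGroup M]
  [module : Module k M]
  rep : Representation k (Equiv.Perm (Fin 2)) M
  R : Submodule k (Quad k M)
  rotate_mem : ∀ r ∈ R, Quad.rotate r ∈ R
  transpose_mem : ∀ r ∈ R, Quad.transpose rep r ∈ R

attribute [instance] BinQuad.addCommGroup BinQuad.module

/-- The binary quadratic operad `T(M)/⟨R⟩`. -/
noncomputable def BinQuad.operad {k : Type u} [CommRing k] (P : BinQuad.{u, v} k) :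
    SymOperad.{u, max u v} k :=
  (freeOperad P.rep).quotient
    ((freeOperad P.rep).idealSpan ((fun r => ⟨3, Quad.toFree P.rep r⟩) '' (P.R : Set (Quad k P.M))))

/-! ### Linear and total compatibility -/

namespace Quad

variable {k : Type u} [CommRing k] {M : Type v} [AddCommGroup M] [Module k M] {Ω : Type w}

/-- A tree polynomial of weight two with the replica `M_{D 0}` used at the inner vertices and the
replica `M_{D 1}` used at the root vertices. -/
noncomputable def recolor (D : Fin 2 → Ω) : Quad k M →ₗ[k] Quad k (Ω →₀ M) :=
  LinearMap.pi fun c : Fin 3 =>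
    TensorProduct.map (Finsupp.lsingle (D 0)) (Finsupp.lsingle (D 1)) ∘ₗ LinearMap.proj c

open Classical in
/-- The type `c = (c_ω)` of a colouring of the two vertices of a tree of weight two: the colour `ω`
is used `c_ω` times. -/
noncomputable def colorType (D : Fin 2 → Ω) (ω : Ω) : ℕ := Finset.card {v : Fin 2 | D v = ω}

open Classical in
/-- The quasipolarization of type `c` of a tree polynomial of weight two. -/
noncomputable def polarization [Fintype Ω] (c : Ω → ℕ) : Quad k M →ₗ[k] Quad k (Ω →₀ M) :=
  ∑ D : Fin 2 → Ω with colorType D = c, recolor D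

variable (Ω) in
/-- The span of all quasipolarizations of elements of `R`. -/
noncomputable def linRel [Fintype Ω] (R : Submodule k (Quad k M)) :
    Submodule k (Quad k (Ω →₀ M)) :=
  ⨆ c ∈ {c : Ω → ℕ | ∑ ω, c ω = 2}, R.map (polarization c)

variable (Ω) in
/-- The span of the (leveled) matching relations: every relation with its inner vertices coloured by
one element of `Ω`, and its root vertices by one element of `Ω`. -/
noncomputable def matRel (R : Submodule k (Quad k M)) : Submodule k (Quad k (Ω →₀ M)) :=
  ⨆ D : Fin 2 → Ω, R.map (recolor D)

variable (k M Ω) in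
/-- The span of the differences of any two colourings of the same type of a tree monomial of weight
two. By `permRel_eq_span_support` below it is enough to take the tree monomials that occur in a
relation, as soon as every tree monomial does. -/
noncomputable def permRel : Submodule k (Quad k (Ω →₀ M)) :=
  ⨆ (D : Fin 2 → Ω) (D' : Fin 2 → Ω) (_ : colorType D = colorType D'),
    LinearMap.range (recolor D - recolor D' : Quad k M →ₗ[k] Quad k (Ω →₀ M))

theorem rotate_recolor (D : Fin 2 → Ω) (x : Quad k M) :
    rotate (recolor D x) = recolor D (rotate x) := rfl

theorem transpose_recolor (ρ : Representation k (Equiv.Perm (Fin 2)) M) (D : Fin 2 → Ω)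
    (x : Quad k M) : transpose (ρ.finsupp Ω) (recolor D x) = recolor D (transpose ρ x) := by
  funext c
  simp only [transpose, recolor, LinearMap.pi_apply, LinearMap.comp_apply, LinearMap.proj_apply]
  induction x (-c) using TensorProduct.induction_on with
  | zero => simp
  | tmul a b => simp
  | add a b ha hb => simp only [map_add, ha, hb]

theorem rotate_polarization [Fintype Ω] (c : Ω → ℕ) (x : Quad k M) :
    rotate (polarization c x) = polarization c (rotate x) := by
  simp [polarization, rotate_recolor]

theorem transpose_polarization [Fintype Ω] (ρ : Representation k (Equiv.Perm (Fin 2)) M)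
    (c : Ω → ℕ) (x : Quad k M) :
    transpose (ρ.finsupp Ω) (polarization c x) = polarization c (transpose ρ x) := by
  simp [polarization, transpose_recolor]

theorem linRel_stable [Fintype Ω] {R : Submodule k (Quad k M)} {f : Quad k M →ₗ[k] Quad k M}
    {g : Quad k (Ω →₀ M) →ₗ[k] Quad k (Ω →₀ M)}
    (h : ∀ c x, g (polarization c x) = polarization c (f x)) (hf : ∀ r ∈ R, f r ∈ R) :
    ∀ r ∈ linRel Ω R, g r ∈ linRel Ω R := by
  have : linRel Ω R ≤ (linRel Ω R).comap g := by
    refine iSup₂_le fun c hc => ?_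
    rintro _ ⟨x, hx, rfl⟩
    rw [Submodule.mem_comap, h]
    exact Submodule.mem_iSup_of_mem c (Submodule.mem_iSup_of_mem hc ⟨f x, hf x hx, rfl⟩)
  exact this

theorem totRel_stable {R : Submodule k (Quad k M)} {f : Quad k M →ₗ[k] Quad k M}
    {g : Quad k (Ω →₀ M) →ₗ[k] Quad k (Ω →₀ M)}
    (h : ∀ D x, g (recolor D x) = recolor D (f x)) (hf : ∀ r ∈ R, f r ∈ R) :
    ∀ r ∈ matRel Ω R ⊔ permRel k M Ω, g r ∈ matRel Ω R ⊔ permRel k M Ω := by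
  have : matRel Ω R ⊔ permRel k M Ω ≤ (matRel Ω R ⊔ permRel k M Ω).comap g := by
    refine sup_le (iSup_le fun D => ?_) (iSup_le fun D => iSup_le fun D' => iSup_le fun hD => ?_)
    · rintro _ ⟨x, hx, rfl⟩
      rw [Submodule.mem_comap, h]
      exact Submodule.mem_sup_left (Submodule.mem_iSup_of_mem D ⟨f x, hf x hx, rfl⟩)
    · rintro _ ⟨x, rfl⟩
      rw [Submodule.mem_comap, LinearMap.sub_apply, map_sub, h, h]
      exact Submodule.mem_sup_right (Submodule.mem_iSup_of_mem D (Submodule.mem_iSup_of_mem D'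
        (Submodule.mem_iSup_of_mem hD ⟨f x, rfl⟩)))
  exact this

/-- Suppose that every tree monomial of weight two in a basis `b` of `M` occurs in some relation.
Then the differences of colourings of the tree monomials that occur in relations span all
differences of colourings. -/
theorem permRel_eq_span_support {ι : Type*} (b : Module.Basis ι k M) (R : Submodule k (Quad k M))
    (hR : ∀ c i j, ∃ r ∈ R, (b.tensorProduct b).repr (r c) (i, j) ≠ 0) :
    permRel k M Ω = Submodule.span k {z | ∃ c i j, (∃ r ∈ R,
      (b.tensorProduct b).repr (r c) (i, j) ≠ 0) ∧ ∃ D D' : Fin 2 → Ω, colorType D = colorType D' ∧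
        z = recolor D (Pi.single c (b i ⊗ₜ b j)) - recolor D' (Pi.single c (b i ⊗ₜ b j))} := by
  apply le_antisymm
  · refine iSup_le fun D => iSup_le fun D' => iSup_le fun hD => ?_
    rw [LinearMap.range_eq_map, ← (Pi.basis fun _ : Fin 3 => b.tensorProduct b).span_eq,
      Submodule.map_span, Submodule.span_le]
    rintro _ ⟨_, ⟨⟨c, i, j⟩, rfl⟩, rfl⟩
    refine Submodule.subset_span ⟨c, i, j, hR c i j, D, D', hD, ?_⟩
    simp
  · rw [Submodule.span_le]
    rintro _ ⟨c, i, j, -, D, D', hD, rfl⟩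
    exact Submodule.mem_iSup_of_mem D (Submodule.mem_iSup_of_mem D' (Submodule.mem_iSup_of_mem hD
      ⟨Pi.single c (b i ⊗ₜ b j), rfl⟩))

end Quad

namespace BinQuad

variable {k : Type u} [CommRing k]

/-- The presentation of the linearly compatible operad `Lin(P)_Ω`. -/
noncomputable def lin (Ω : Type w) [Fintype Ω] (P : BinQuad.{u, v} k) : BinQuad.{u, max w v} k where
  M := Ω →₀ P.M
  rep := P.rep.finsupp Ω
  R := Quad.linRel Ω P.R
  rotate_mem := Quad.linRel_stable Quad.rotate_polarization P.rotate_mem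
  transpose_mem := Quad.linRel_stable (Quad.transpose_polarization P.rep) P.transpose_mem

/-- The presentation of the totally compatible operad `Tot(P)_Ω`. -/
noncomputable def tot (Ω : Type w) (P : BinQuad.{u, v} k) : BinQuad.{u, max w v} k where
  M := Ω →₀ P.M
  rep := P.rep.finsupp Ω
  R := Quad.matRel Ω P.R ⊔ Quad.permRel k P.M Ω
  rotate_mem := Quad.totRel_stable Quad.rotate_recolor P.rotate_mem
  transpose_mem := Quad.totRel_stable (Quad.transpose_recolor P.rep) P.transpose_mem

end BinQuad

/-! ### Manin products -/

/-- The representation `M ⊗ sgn`. -/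
noncomputable def signTwist {k : Type u} [CommRing k] {M : Type v} [AddCommGroup M] [Module k M]
    (ρ : Representation k (Equiv.Perm (Fin 2)) M) : Representation k (Equiv.Perm (Fin 2)) M where
  toFun σ := ((Equiv.Perm.sign σ : ℤ) : k) • ρ σ
  map_one' := by simp
  map_mul' σ τ := by
    ext x
    simp [smul_smul, mul_comm]

namespace Quad

variable {k : Type u} [CommRing k] {M : Type v} [AddCommGroup M] [Module k M]
  {N : Type w} [AddCommGroup N] [Module k N]

/-- The map `Ψ : T(M)(3) ⊗ T(N)(3) → T(M ⊗ N)(3)` that sends trees of the same shape with vertices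
`μ, μ'` and `ν, ν'` to the tree with vertices `μ ⊗ ν, μ' ⊗ ν'`, and trees of different shapes to
zero. -/
noncomputable def prodMap : Quad k M →ₗ[k] Quad k N →ₗ[k] Quad k (M ⊗[k] N) :=
  LinearMap.mk₂ k
    (fun x y c => TensorProduct.tensorTensorTensorComm k M M N N (x c ⊗ₜ y c))
    (fun x x' y => by funext c; simp [TensorProduct.add_tmul])
    (fun a x y => by
      funext c
      rw [Pi.smul_apply, Pi.smul_apply, ← TensorProduct.smul_tmul', map_smul])
    (fun x y y' => by funext c; simp [TensorProduct.tmul_add])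
    (fun a x y => by funext c; simp)

/-- The map `Φ : T(M ⊗ N)(3) → T(M)(3) ⊗ T(N)(3)` that sends a tree with vertices
`μ ⊗ ν, μ' ⊗ ν'` to the tensor product of the trees of the same shape with vertices `μ, μ'` and
`ν, ν'`. -/
noncomputable def splitMap : Quad k (M ⊗[k] N) →ₗ[k] Quad k M ⊗[k] Quad k N :=
  ∑ c : Fin 3,
    TensorProduct.map (LinearMap.single k (fun _ : Fin 3 => M ⊗[k] M) c)
      (LinearMap.single k (fun _ : Fin 3 => N ⊗[k] N) c) ∘ₗ
    (TensorProduct.tensorTensorTensorComm k M N M N).toLinearMap ∘ₗ LinearMap.proj c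

/-- `R • S`: the span of all `Ψ(r ⊗ s)`. -/
noncomputable def blackRel (R : Submodule k (Quad k M)) (S : Submodule k (Quad k N)) :
    Submodule k (Quad k (M ⊗[k] N)) :=
  Submodule.map₂ prodMap R S

/-- `R ∘ S = Φ⁻¹(R ⊗ T(N)(3) + T(M)(3) ⊗ S)`. -/
noncomputable def whiteRel (R : Submodule k (Quad k M)) (S : Submodule k (Quad k N)) :
    Submodule k (Quad k (M ⊗[k] N)) :=
  (Submodule.map₂ (TensorProduct.mk k (Quad k M) (Quad k N)) R ⊤ ⊔
    Submodule.map₂ (TensorProduct.mk k (Quad k M) (Quad k N)) ⊤ S).comap splitMap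

theorem rotate_prodMap (x : Quad k M) (y : Quad k N) :
    rotate (prodMap x y) = prodMap (rotate x) (rotate y) := rfl

theorem transpose_prodMap (ρ : Representation k (Equiv.Perm (Fin 2)) M)
    (ρ' : Representation k (Equiv.Perm (Fin 2)) N) (x : Quad k M) (y : Quad k N) :
    transpose (signTwist (ρ.tprod ρ')) (prodMap x y) =
      -prodMap (transpose ρ x) (transpose ρ' y) := by
  funext c
  change TensorProduct.map _ _ (TensorProduct.tensorTensorTensorComm k M M N N
    (x (-c) ⊗ₜ y (-c))) = -TensorProduct.tensorTensorTensorComm k M M N N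
      (TensorProduct.map _ _ (x (-c)) ⊗ₜ TensorProduct.map _ _ (y (-c)))
  induction x (-c) using TensorProduct.induction_on with
  | zero => simp
  | add a b ha hb => simp only [TensorProduct.add_tmul, map_add, ha, hb, neg_add]
  | tmul a a' =>
    induction y (-c) using TensorProduct.induction_on with
    | zero => simp
    | add a b ha hb => simp only [TensorProduct.tmul_add, map_add, ha, hb, neg_add]
    | tmul b b' => simp [signTwist, TensorProduct.neg_tmul]

theorem blackRel_stable {R : Submodule k (Quad k M)} {S : Submodule k (Quad k N)}
    {f : Quad k M →ₗ[k] Quad k M} {f' : Quad k N →ₗ[k] Quad k N}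
    {g : Quad k (M ⊗[k] N) →ₗ[k] Quad k (M ⊗[k] N)}
    (h : ∀ x y, g (prodMap x y) = prodMap (f x) (f' y) ∨ g (prodMap x y) = -prodMap (f x) (f' y))
    (hf : ∀ r ∈ R, f r ∈ R) (hf' : ∀ s ∈ S, f' s ∈ S) :
    ∀ r ∈ blackRel R S, g r ∈ blackRel R S := by
  have : blackRel R S ≤ (blackRel R S).comap g := by
    refine Submodule.map₂_le.2 fun x hx y hy => ?_
    rw [Submodule.mem_comap]
    have h1 := Submodule.apply_mem_map₂ prodMap (hf x hx) (hf' y hy)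
    rcases h x y with h | h
    · rw [h]; exact h1
    · rw [h]; exact neg_mem h1
  exact this

theorem rotate_single (c : Fin 3) (a : M ⊗[k] M) :
    rotate (Pi.single c a : Quad k M) = Pi.single (c + 1) a := by
  funext d
  change (Pi.single c a : Quad k M) (d - 1) = _
  simp only [Pi.single_apply, sub_eq_iff_eq_add]

theorem transpose_single (ρ : Representation k (Equiv.Perm (Fin 2)) M) (c : Fin 3)
    (a : M ⊗[k] M) : transpose ρ (Pi.single c a) =
      Pi.single (-c) (TensorProduct.map (ρ (Equiv.swap 0 1)) LinearMap.id a) := by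
  funext d
  change TensorProduct.map _ _ ((Pi.single c a : Quad k M) (-d)) = _
  by_cases h : d = -c
  · subst h; simp
  · have h' : -d ≠ c := fun h' => h (by rw [← h', neg_neg])
    simp [h, h']

theorem splitMap_single (c : Fin 3) (m m' : M) (n n' : N) :
    splitMap (k := k) (Pi.single c ((m ⊗ₜ n) ⊗ₜ (m' ⊗ₜ n'))) =
      (Pi.single c (m ⊗ₜ m') : Quad k M) ⊗ₜ[k] (Pi.single c (n ⊗ₜ n') : Quad k N) := by
  rw [splitMap, LinearMap.sum_apply, Finset.sum_eq_single c]
  · simp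
  · intro d _ hd
    simp [hd]
  · simp

theorem splitMap_rotate (z : Quad k (M ⊗[k] N)) :
    splitMap (rotate z) = TensorProduct.map rotate rotate (splitMap z) := by
  have h : (splitMap (k := k) (M := M) (N := N)) ∘ₗ rotate =
      TensorProduct.map rotate rotate ∘ₗ splitMap := by
    ext c m n m' n'
    simp [rotate_single, splitMap_single]
  exact LinearMap.congr_fun h z

theorem splitMap_transpose (ρ : Representation k (Equiv.Perm (Fin 2)) M)
    (ρ' : Representation k (Equiv.Perm (Fin 2)) N) (z : Quad k (M ⊗[k] N)) :
    splitMap (transpose (ρ.tprod ρ') z) =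
      TensorProduct.map (transpose ρ) (transpose ρ') (splitMap z) := by
  have h : splitMap ∘ₗ transpose (ρ.tprod ρ') =
      TensorProduct.map (transpose ρ) (transpose ρ') ∘ₗ splitMap := by
    ext c m n m' n'
    simp [transpose_single, splitMap_single]
  exact LinearMap.congr_fun h z

theorem whiteRel_stable {R : Submodule k (Quad k M)} {S : Submodule k (Quad k N)}
    {f : Quad k M →ₗ[k] Quad k M} {f' : Quad k N →ₗ[k] Quad k N}
    {g : Quad k (M ⊗[k] N) →ₗ[k] Quad k (M ⊗[k] N)}
    (h : ∀ z, splitMap (g z) = TensorProduct.map f f' (splitMap z))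
    (hf : ∀ r ∈ R, f r ∈ R) (hf' : ∀ s ∈ S, f' s ∈ S) :
    ∀ r ∈ whiteRel R S, g r ∈ whiteRel R S := by
  intro z hz
  rw [whiteRel, Submodule.mem_comap] at hz ⊢
  rw [h, ← Submodule.mem_comap (f := TensorProduct.map f f')]
  revert hz
  apply (show ∀ {A B : Submodule k (Quad k M ⊗[k] Quad k N)} {t}, A ≤ B → t ∈ A → t ∈ B from
    fun h ht => h ht)
  refine sup_le (Submodule.map₂_le.2 fun x hx y _ => ?_) (Submodule.map₂_le.2 fun x _ y hy => ?_)
  · exact Submodule.mem_sup_left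
      (Submodule.apply_mem_map₂ _ (hf x hx) (Submodule.mem_top (x := f' y)))
  · exact Submodule.mem_sup_right
      (Submodule.apply_mem_map₂ _ (Submodule.mem_top (x := f x)) (hf' y hy))

end Quad

namespace BinQuad

variable {k : Type u} [CommRing k]

/-- The presentation of the Manin black product `P • Q`, with generators `M ⊗ N ⊗ sgn`. -/
noncomputable def black (P : BinQuad.{u, v} k) (Q : BinQuad.{u, w} k) :
    BinQuad.{u, max v w} k where
  M := P.M ⊗[k] Q.M
  rep := signTwist (P.rep.tprod Q.rep)
  R := Quad.blackRel P.R Q.R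
  rotate_mem := Quad.blackRel_stable (fun x y => Or.inl (Quad.rotate_prodMap x y))
    P.rotate_mem Q.rotate_mem
  transpose_mem := Quad.blackRel_stable
    (fun x y => Or.inr (Quad.transpose_prodMap P.rep Q.rep x y)) P.transpose_mem Q.transpose_mem

/-- The presentation of the Manin white product `P ∘ Q`, with generators `M ⊗ N`. -/
noncomputable def white (P : BinQuad.{u, v} k) (Q : BinQuad.{u, w} k) :
    BinQuad.{u, max v w} k where
  M := P.M ⊗[k] Q.M
  rep := P.rep.tprod Q.rep
  R := Quad.whiteRel P.R Q.R
  rotate_mem := Quad.whiteRel_stable Quad.splitMap_rotate P.rotate_mem Q.rotate_mem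
  transpose_mem := Quad.whiteRel_stable (Quad.splitMap_transpose P.rep Q.rep)
    P.transpose_mem Q.transpose_mem

/-! ### The operads `Lie` and `Com` -/

variable (k) in
/-- The operad of Lie algebras: an antisymmetric generator with the Jacobi identity
`((1 2) 3) + ((2 3) 1) + ((3 1) 2) = 0`. -/
noncomputable def lie : BinQuad.{u, u} k where
  M := k
  rep := signTwist (Representation.trivial k (Equiv.Perm (Fin 2)) k)
  R := Submodule.span k {((fun _ => 1 ⊗ₜ 1) : Quad k k)}
  rotate_mem := by
    intro r hr
    obtain ⟨a, rfl⟩ := Submodule.mem_span_singleton.1 hr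
    exact hr
  transpose_mem := by
    intro r hr
    obtain ⟨a, rfl⟩ := Submodule.mem_span_singleton.1 hr
    refine Submodule.mem_span_singleton.2 ⟨-a, ?_⟩
    funext c
    simp [Quad.transpose, signTwist, TensorProduct.neg_tmul]

variable (k) in
/-- The operad of commutative (associative) algebras: a symmetric generator with the relations
`((1 2) 3) = ((2 3) 1) = ((3 1) 2)`. -/
noncomputable def com : BinQuad.{u, u} k where
  M := k
  rep := Representation.trivial k (Equiv.Perm (Fin 2)) k
  R := Submodule.span k {
    (Pi.single (0 : Fin 3) ((1 : k) ⊗ₜ[k] (1 : k)) -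
      Pi.single (1 : Fin 3) ((1 : k) ⊗ₜ[k] (1 : k)) : Quad k k),
    (Pi.single (0 : Fin 3) ((1 : k) ⊗ₜ[k] (1 : k)) -
      Pi.single (2 : Fin 3) ((1 : k) ⊗ₜ[k] (1 : k)) : Quad k k)}
  rotate_mem := by
    intro r hr
    obtain ⟨a, b, rfl⟩ := Submodule.mem_span_pair.1 hr
    refine Submodule.mem_span_pair.2 ⟨-a - b, a, ?_⟩
    simp only [map_add, map_smul, map_sub, Quad.rotate_single]
    have h0 : (0 + 1 : Fin 3) = 1 := rfl
    have h1 : (1 + 1 : Fin 3) = 2 := rfl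
    have h2 : (2 + 1 : Fin 3) = 0 := rfl
    rw [h0, h1, h2]
    module
  transpose_mem := by
    intro r hr
    obtain ⟨a, b, rfl⟩ := Submodule.mem_span_pair.1 hr
    refine Submodule.mem_span_pair.2 ⟨b, a, ?_⟩
    simp only [map_add, map_smul, map_sub, Quad.transpose_single]
    have h0 : (-0 : Fin 3) = 0 := rfl
    have h1 : (-1 : Fin 3) = 2 := rfl
    have h2 : (-2 : Fin 3) = 1 := rfl
    rw [h0, h1, h2]
    simp only [TensorProduct.map_tmul, Representation.trivial_apply, LinearMap.id_apply]
    module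

end BinQuad

/-! A replica $\mu_\omega$ is the same thing as a tensor $e_\omega\otimes\mu$, so $M_\Omega\cong
k^\Omega\otimes M$, and both claimed isomorphisms are induced by this single identification of
generators (`Quad.colorEquiv`). It is equivariant in both cases: ${\rm Com}$ has the trivial action,
while the sign of ${\rm Lie}$ cancels the twist in the black product. By functoriality of the free
operad (`BinQuad.nonempty_iso`), it remains to match the quadratic relations in arity three.

Black product: the Jacobi element $J$ has the coordinate $1\otimes 1$ at each of the three tree
shapes, and $\Psi$ multiplies shape by shape. Hence $\Psi(J^D\otimes r)$ is $r^D$ for every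
colouring $D$ of the two vertices (`Quad.prodMap_recolor`). Summing over the colourings of a given
type, quasipolarizations of $J$ paired with $r$ become quasipolarizations of $r$, and the two
relation spaces agree (`Quad.map_linRel`).

White product: let $e_c^D$ be the tree of shape $c$ over $k^\Omega$ coloured by $D$. If $r=\sum_c
r_c$ is split by shapes, then $\Phi(r^D)=\sum_c e_c^D\otimes r_c$ (`Quad.splitMap_map_recolor`).
Modulo the relations of ${\rm Com}$ the shape of $e_c^D$ is irrelevant, so this is $e_0^D\otimes r$
and matching relations go to relations; differences of colourings do so termwise
(`Quad.map_mem_whiteRel`).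

For the converse, `Quad.paint` sends $e_c^D\otimes x$ to $x^D$. It is a left inverse of $\Phi$
(`Quad.paint_splitMap_map`), it kills the matching relations of ${\rm Com}$ in the first factor, and
it sends the remaining generators of the white relations into the relations of ${\rm Tot}(\mathcal
P)_\Omega$. Applying it to $\Phi(z)$ recovers $z$ and exhibits it as a relation. -/

/-! ### Isomorphisms of operads, ideals and quotients. -/

namespace SymOperad

variable {k : Type u} [CommRing k] {P : SymOperad.{u, v} k} {Q : SymOperad.{u, w} k}

/-- The inverse of an isomorphism of operads. -/
noncomputable def Iso.symm (φ : P.Iso Q) : Q.Iso P where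
  toEquiv n := (φ.toEquiv n).symm
  map_one := by rw [← φ.map_one, LinearEquiv.symm_apply_apply]
  map_relabel σ p := by
    apply (φ.toEquiv _).injective
    simp [φ.map_relabel]
  map_comp e p q := by
    apply (φ.toEquiv _).injective
    simp [φ.map_comp]

/-- The preimage of an operadic ideal under an isomorphism. -/
noncomputable def Ideal.comap (φ : P.Iso Q) (J : Ideal Q) : Ideal P where
  carrier n := (J.carrier n).comap (φ.toEquiv n).toLinearMap
  relabel_mem σ p hp := by
    simpa [φ.map_relabel] using J.relabel_mem σ hp
  comp_mem_left e p q hp := by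
    simpa [φ.map_comp] using J.comp_mem_left e (fun i => φ.toEquiv _ (q i)) hp
  comp_mem_right e p q i hq := by
    simpa [φ.map_comp] using
      J.comp_mem_right e (φ.toEquiv _ p) (fun i => φ.toEquiv _ (q i)) i hq

theorem idealSpan_le_of_subset (I : Ideal P) {S : Set (Σ n : ℕ, P.obj n)}
    (h : ∀ x ∈ S, x.2 ∈ I.carrier x.1) (n : ℕ) : (P.idealSpan S).carrier n ≤ I.carrier n :=
  iInf₂_le I h

theorem mem_idealSpan {S : Set (Σ n : ℕ, P.obj n)} {x : Σ n : ℕ, P.obj n} (hx : x ∈ S) :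
    x.2 ∈ (P.idealSpan S).carrier x.1 := by
  simp only [idealSpan, Submodule.mem_iInf]
  exact fun I hI => hI x hx

/-- An isomorphism of operads that matches two ideals induces an isomorphism of the quotients. -/
noncomputable def Iso.quotient (φ : P.Iso Q) (I : Ideal P) (J : Ideal Q)
    (h : ∀ n, (I.carrier n).map (φ.toEquiv n).toLinearMap = J.carrier n) :
    (P.quotient I).Iso (Q.quotient J) where
  toEquiv n := Submodule.Quotient.equiv (I.carrier n) (J.carrier n) (φ.toEquiv n) (h n)
  map_one := congrArg (J.carrier 1).mkQ φ.map_one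
  map_relabel {n} σ p := by
    obtain ⟨p, rfl⟩ := Submodule.mkQ_surjective _ p
    exact congrArg (J.carrier n).mkQ (φ.map_relabel σ p)
  map_comp {m n N} e p q := by
    obtain ⟨p, rfl⟩ := Submodule.mkQ_surjective _ p
    choose q' hq using fun i => Submodule.mkQ_surjective _ (q i)
    obtain rfl : (fun i => (I.carrier _).mkQ (q' i)) = q := funext hq
    have h1 : (P.quotient I).comp e ((I.carrier m).mkQ p) (fun i => (I.carrier (n i)).mkQ (q' i)) =
        (I.carrier N).mkQ (P.comp e p q') := P.quotientComp_mk I e p q'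
    rw [h1]
    exact (congrArg (J.carrier N).mkQ (φ.map_comp e p q')).trans
      (Q.quotientComp_mk J e (φ.toEquiv m p) fun i => φ.toEquiv (n i) (q' i)).symm

/-- Pulling an ideal back along an isomorphism gives an ideal, so minimality of the generated ideal
yields each inclusion from generators alone, without describing the elements of the ideal. -/
theorem map_idealSpan (φ : P.Iso Q) {S : Set (Σ n : ℕ, P.obj n)} {T : Set (Σ n : ℕ, Q.obj n)}
    (h : ∀ x ∈ S, ⟨x.1, φ.toEquiv x.1 x.2⟩ ∈ T) (h' : ∀ y ∈ T, ⟨y.1, φ.symm.toEquiv y.1 y.2⟩ ∈ S)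
    (n : ℕ) : ((P.idealSpan S).carrier n).map (φ.toEquiv n).toLinearMap =
      (Q.idealSpan T).carrier n := by
  apply le_antisymm
  · exact Submodule.map_le_iff_le_comap.2 (idealSpan_le_of_subset ((Q.idealSpan T).comap φ)
      (fun x hx => mem_idealSpan (h x hx)) n)
  · intro y hy
    exact ⟨φ.symm.toEquiv n y, idealSpan_le_of_subset ((P.idealSpan S).comap φ.symm)
      (fun x hx => mem_idealSpan (h' x hx)) n hy, (φ.toEquiv n).apply_symm_apply y⟩

end SymOperad

/-! ### Functoriality of the free operad in its module of generators. -/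

namespace FreeOperad

section Map

variable {k : Type u} {M : Type v} {N : Type w}

/-- The formal expression obtained by applying a map to the generators. -/
def Pre.map (f : M → N) : ∀ {n : ℕ}, Pre k M n → Pre k N n
  | _, .gen x => .gen (f x)
  | _, .one => .one
  | _, .relabel σ p => .relabel σ (p.map f)
  | _, .comp e p q => .comp e (p.map f) (fun i => (q i).map f)
  | _, .zero => .zero
  | _, .add p p' => .add (p.map f) (p'.map f)
  | _, .smul a p => .smul a (p.map f)

/-- Needed for the two constructors of `Rel` that express linearity of a composition in its right
arguments, as these are phrased with `Function.update`. -/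
theorem Pre.map_update (f : M → N) {m : ℕ} {n : Fin m → ℕ} (q : ∀ i, Pre k M (n i)) (i : Fin m)
    (x : Pre k M (n i)) : (fun j => (Function.update q i x j).map f) =
      Function.update (fun j => (q j).map f) i (x.map f) := by
  funext j
  exact Function.apply_update (fun _ => Pre.map f) q i x j

theorem Pre.map_map_of_leftInverse {f : M → N} {g : N → M} (h : Function.LeftInverse g f) {n : ℕ}
    (p : Pre k M n) : (p.map f).map g = p := by
  induction p <;> simp_all [Pre.map, h _]

end Map

variable {k : Type u} [CommRing k] {M : Type v} [AddCommGroup M] [Module k M]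
  {N : Type w} [AddCommGroup N] [Module k N]
  {ρ : Representation k (Equiv.Perm (Fin 2)) M}
  {ρ' : Representation k (Equiv.Perm (Fin 2)) N}

/-- Each constructor goes to the same constructor. Linearity and equivariance of `f` enter only in
the last three cases, which concern generators. -/
theorem Rel.map (f : M →ₗ[k] N) (hf : ∀ σ x, f (ρ σ x) = ρ' σ (f x)) {n : ℕ} {p p' : Pre k M n}
    (h : Rel ρ p p') : Rel ρ' (p.map f) (p'.map f) := by
  induction h with
  | refl p => exact .refl _
  | symm _ ih => exact .symm ih
  | trans _ _ ih ih' => exact .trans ih ih'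
  | relabel_congr σ _ ih => exact .relabel_congr σ ih
  | comp_congr e _ _ ih ih' => exact .comp_congr e ih ih'
  | add_congr _ _ ih ih' => exact .add_congr ih ih'
  | smul_congr a _ ih => exact .smul_congr a ih
  | add_assoc p q r => exact .add_assoc _ _ _
  | add_comm p q => exact .add_comm _ _
  | zero_add p => exact .zero_add _
  | neg_add p => exact .neg_add _
  | smul_add a p q => exact .smul_add _ _ _
  | add_smul a b p => exact .add_smul _ _ _
  | mul_smul a b p => exact .mul_smul _ _ _
  | one_smul p => exact .one_smul _
  | relabel_add σ p p' => exact .relabel_add _ _ _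
  | relabel_smul σ a p => exact .relabel_smul _ _ _
  | comp_add_left e p p' q => exact .comp_add_left _ _ _ _
  | comp_smul_left e a p q => exact .comp_smul_left _ _ _ _
  | comp_add_right e p q i x y =>
    simp only [Pre.map, Pre.map_update]
    exact .comp_add_right _ _ _ _ _ _
  | comp_smul_right e p q i a x =>
    simp only [Pre.map, Pre.map_update]
    exact .comp_smul_right _ _ _ _ _ _
  | relabel_one p => exact .relabel_one _
  | relabel_mul σ τ p => exact .relabel_mul _ _ _
  | relabel_comp e σ p q => exact .relabel_comp _ _ _ _
  | comp_relabel_right e σ p q => exact .comp_relabel_right e σ _ _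
  | comp_relabel_left e σ p q => exact .comp_relabel_left e σ _ (fun i => (q i).map f)
  | one_comp q => exact .one_comp _
  | comp_one p => exact .comp_one _
  | assoc g f' e p q r =>
    exact .assoc g f' e (p.map f) (fun i => (q i).map f) (fun i j => (r i j).map f)
  | gen_add x y =>
    simp only [Pre.map, map_add]
    exact .gen_add _ _
  | gen_smul a x =>
    simp only [Pre.map, map_smul]
    exact .gen_smul _ _
  | gen_relabel σ x =>
    simp only [Pre.map, hf]
    exact .gen_relabel _ _

/-- The map of free operads induced by an equivariant map. -/
def objMap (f : M →ₗ[k] N) (hf : ∀ σ x, f (ρ σ x) = ρ' σ (f x)) (n : ℕ) :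
    Obj ρ n →ₗ[k] Obj ρ' n where
  toFun x := Quotient.map (sa := setoid ρ n) (sb := setoid ρ' n) (Pre.map f)
    (fun _ _ h => Rel.map f hf h) x
  map_add' x y := by
    obtain ⟨x, rfl⟩ := mk_surj x
    obtain ⟨y, rfl⟩ := mk_surj y
    rfl
  map_smul' a x := by
    obtain ⟨x, rfl⟩ := mk_surj x
    rfl

theorem objMap_mk (f : M →ₗ[k] N) (hf : ∀ σ x, f (ρ σ x) = ρ' σ (f x)) {n : ℕ} (p : Pre k M n) :
    objMap f hf n (mk ρ p) = mk ρ' (p.map f) := rfl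

theorem objMap_objMap_of_leftInverse (f : M →ₗ[k] N) (hf : ∀ σ x, f (ρ σ x) = ρ' σ (f x))
    (g : N →ₗ[k] M) (hg : ∀ σ x, g (ρ' σ x) = ρ σ (g x)) (h : Function.LeftInverse g f) (n : ℕ)
    (x : Obj ρ n) : objMap g hg n (objMap f hf n x) = x := by
  obtain ⟨x, rfl⟩ := mk_surj x
  rw [objMap_mk, objMap_mk, Pre.map_map_of_leftInverse h]

end FreeOperad

section FreeOperadIso

variable {k : Type u} [CommRing k] {M : Type v} [AddCommGroup M] [Module k M]
  {N : Type w} [AddCommGroup N] [Module k N] {ρ : Representation k (Equiv.Perm (Fin 2)) M}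
  {ρ' : Representation k (Equiv.Perm (Fin 2)) N}

/-- The isomorphism of free operads induced by an isomorphism of `S₂`-modules. -/
noncomputable def freeOperadIso (f : M ≃ₗ[k] N) (hf : ∀ σ x, f (ρ σ x) = ρ' σ (f x)) :
    (freeOperad ρ).Iso (freeOperad ρ') where
  toEquiv n :=
    have hg : ∀ σ x, f.symm (ρ' σ x) = ρ σ (f.symm x) := fun σ x =>
      f.injective (by simp [hf])
    { FreeOperad.objMap f.toLinearMap hf n with
      invFun := FreeOperad.objMap f.symm.toLinearMap hg n
      left_inv := FreeOperad.objMap_objMap_of_leftInverse f.toLinearMap hf f.symm.toLinearMap hg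
        f.left_inv n
      right_inv := FreeOperad.objMap_objMap_of_leftInverse f.symm.toLinearMap hg f.toLinearMap hf
        f.right_inv n }
  map_one := rfl
  map_relabel σ p := by
    obtain ⟨p, rfl⟩ := FreeOperad.mk_surj p
    rfl
  map_comp {m n N} e p q := by
    obtain ⟨p, rfl⟩ := FreeOperad.mk_surj p
    choose q' hq using fun i => FreeOperad.mk_surj (q i)
    obtain rfl : (fun i => FreeOperad.mk ρ (q' i)) = q := funext hq
    exact (congrArg (FreeOperad.objMap f.toLinearMap hf N) (FreeOperad.objComp_mk e p q')).trans
      (FreeOperad.objComp_mk e (p.map f) fun i => (q' i).map f).symm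

theorem freeOperadIso_gen (f : M ≃ₗ[k] N) (hf : ∀ σ x, f (ρ σ x) = ρ' σ (f x)) (x : M) :
    (freeOperadIso f hf).toEquiv 2 (freeOperadGen ρ x) = freeOperadGen ρ' (f x) := rfl

end FreeOperadIso

/-! ### Quadratic elements and isomorphisms of presentations. -/

namespace SymOperad.Iso

variable {k : Type u} [CommRing k] {P : SymOperad.{u, v} k} {Q : SymOperad.{u, w} k}

/-- The partial composition in `graft` is a full composition with the identity in the second slot,
so preserving it relies on `φ.map_one` as well as on `φ.map_comp`. -/
theorem map_withOne (φ : P.Iso Q) (q : P.obj 2) :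
    (fun i => φ.toEquiv _ (P.withOne q i)) = Q.withOne (φ.toEquiv 2 q) := by
  funext i
  fin_cases i
  · rfl
  · exact φ.map_one

theorem map_graft (φ : P.Iso Q) (q p : P.obj 2) :
    φ.toEquiv 3 (P.graft (q ⊗ₜ p)) = Q.graft (φ.toEquiv 2 q ⊗ₜ φ.toEquiv 2 p) :=
  (φ.map_comp combEquiv p (P.withOne q)).trans
    (congrArg (Q.comp combEquiv (φ.toEquiv 2 p)) (φ.map_withOne q))

end SymOperad.Iso

namespace Quad

variable {k : Type u} [CommRing k] {M : Type v} [AddCommGroup M] [Module k M]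
  {N : Type w} [AddCommGroup N] [Module k N]

/-- The map of tree polynomials of weight two induced by a map of generators. -/
noncomputable def map (f : M →ₗ[k] N) : Quad k M →ₗ[k] Quad k N :=
  LinearMap.pi fun c : Fin 3 => TensorProduct.map f f ∘ₗ LinearMap.proj c

theorem map_single (f : M →ₗ[k] N) (c : Fin 3) (a b : M) :
    map f (Pi.single c (a ⊗ₜ b)) = Pi.single c (f a ⊗ₜ[k] f b) := by
  funext d
  by_cases h : d = c
  · subst h; simp [map]
  · simp [map, h]

theorem map_symm_map (f : M ≃ₗ[k] N) (x : Quad k M) :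
    map f.symm.toLinearMap (map f.toLinearMap x) = x := by
  have h : map f.symm.toLinearMap ∘ₗ map f.toLinearMap = (LinearMap.id : Quad k M →ₗ[k] _) := by
    ext c a b : 5
    simp [map_single]
  exact LinearMap.congr_fun h x

theorem map_map_symm (f : M ≃ₗ[k] N) (y : Quad k N) :
    map f.toLinearMap (map f.symm.toLinearMap y) = y :=
  map_symm_map f.symm y

variable {ρ : Representation k (Equiv.Perm (Fin 2)) M}
  {ρ' : Representation k (Equiv.Perm (Fin 2)) N}

theorem toFree_single (c : Fin 3) (a b : M) : toFree ρ (Pi.single c (a ⊗ₜ b)) =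
    (freeOperad ρ).relabel (finRotate 3 ^ (c : ℕ))
      ((freeOperad ρ).graft (freeOperadGen ρ a ⊗ₜ freeOperadGen ρ b)) := by
  rw [toFree, LinearMap.sum_apply, Finset.sum_eq_single c]
  · simp
  · intro d _ hd
    simp [hd]
  · simp

/-- The element attached to given coordinates is built from generators by grafting and relabelling,
all of which an isomorphism of operads respects. -/
theorem toFree_map (f : M ≃ₗ[k] N) (hf : ∀ σ x, f (ρ σ x) = ρ' σ (f x)) (x : Quad k M) :
    (freeOperadIso f hf).toEquiv 3 (toFree ρ x) = toFree ρ' (map f.toLinearMap x) := by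
  have h : ((freeOperadIso f hf).toEquiv 3).toLinearMap ∘ₗ toFree ρ =
      toFree ρ' ∘ₗ map f.toLinearMap := by
    ext c a b : 5
    simp [toFree_single, map_single, (freeOperadIso f hf).map_relabel,
      (freeOperadIso f hf).map_graft, freeOperadIso_gen]
  exact LinearMap.congr_fun h x

end Quad

/-- An isomorphism of presentations induces an isomorphism of operads. -/
theorem BinQuad.nonempty_iso {k : Type u} [CommRing k] (P : BinQuad.{u, v} k)
    (Q : BinQuad.{u, w} k) (f : P.M ≃ₗ[k] Q.M) (hf : ∀ σ x, f (P.rep σ x) = Q.rep σ (f x))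
    (h : ∀ r ∈ P.R, Quad.map f.toLinearMap r ∈ Q.R)
    (h' : ∀ s ∈ Q.R, Quad.map f.symm.toLinearMap s ∈ P.R) : Nonempty (P.operad.Iso Q.operad) := by
  refine ⟨(freeOperadIso f hf).quotient _ _ (SymOperad.map_idealSpan _ ?_ ?_)⟩
  · rintro _ ⟨r, hr, rfl⟩
    exact ⟨_, h r hr, by simp only [Quad.toFree_map]⟩
  · rintro _ ⟨s, hs, rfl⟩
    refine ⟨_, h' s hs, ?_⟩
    -- The inverse of the induced isomorphism is compared with `f.symm` after applying the
    -- isomorphism itself, where `Quad.toFree_map` for `f` suffices.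
    have : (freeOperadIso f hf).symm.toEquiv 3 (Quad.toFree Q.rep s) =
        Quad.toFree P.rep (Quad.map f.symm.toLinearMap s) := by
      apply ((freeOperadIso f hf).toEquiv 3).injective
      rw [Quad.toFree_map, Quad.map_map_symm]
      exact ((freeOperadIso f hf).toEquiv 3).apply_symm_apply _
    simp only [this]

/-! ### Colours as a tensor factor, and the black product with `Lie`. -/

namespace Quad

variable {k : Type u} [CommRing k] {M : Type v} [AddCommGroup M] [Module k M] {Ω : Type w}

variable (k M Ω) in
open Classical in
/-- The isomorphism `M_Ω ≅ k^Ω ⊗ M`. -/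
noncomputable def colorEquiv : (Ω →₀ M) ≃ₗ[k] (Ω →₀ k) ⊗[k] M :=
  (TensorProduct.finsuppScalarLeft k M Ω).symm

@[simp]
theorem colorEquiv_single (i : Ω) (m : M) :
    colorEquiv k M Ω (Finsupp.single i m) = Finsupp.single i 1 ⊗ₜ m := by
  simp [colorEquiv]

theorem colorEquiv_finsupp (ρ : Representation k (Equiv.Perm (Fin 2)) M)
    (σ : Equiv.Perm (Fin 2)) (x : Ω →₀ M) : colorEquiv k M Ω (ρ.finsupp Ω σ x) =
      ((Representation.trivial k (Equiv.Perm (Fin 2)) k).finsupp Ω).tprod ρ σ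
        (colorEquiv k M Ω x) := by
  induction x using Finsupp.induction_linear with
  | zero => simp only [map_zero]
  | add x y hx hy => simp only [map_add, hx, hy]
  | single i m =>
    rw [Representation.tprod_apply]
    simp

/-- One sign comes from the antisymmetric generator of `Lie`, the other from the twist in the black
product; their product is 1. -/
theorem colorEquiv_finsupp_signTwist (ρ : Representation k (Equiv.Perm (Fin 2)) M)
    (σ : Equiv.Perm (Fin 2)) (x : Ω →₀ M) : colorEquiv k M Ω (ρ.finsupp Ω σ x) =
      signTwist (((signTwist (Representation.trivial k (Equiv.Perm (Fin 2)) k)).finsupp Ω).tprod ρ)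
        σ (colorEquiv k M Ω x) := by
  induction x using Finsupp.induction_linear with
  | zero => simp only [map_zero]
  | add x y hx hy => simp only [map_add, hx, hy]
  | single i m =>
    rcases Int.units_eq_one_or (Equiv.Perm.sign σ) with h | h <;>
      simp [signTwist, h, TensorProduct.neg_tmul]

theorem recolor_apply (D : Fin 2 → Ω) (x : Quad k M) (c : Fin 3) : recolor D x c =
    TensorProduct.map (Finsupp.lsingle (D 0)) (Finsupp.lsingle (D 1)) (x c) := rfl

theorem map_apply {N : Type w} [AddCommGroup N] [Module k N] (f : M →ₗ[k] N) (x : Quad k M)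
    (c : Fin 3) : map f x c = TensorProduct.map f f (x c) := rfl

theorem prodMap_apply {N : Type w} [AddCommGroup N] [Module k N] (x : Quad k M) (y : Quad k N)
    (c : Fin 3) : prodMap x y c = TensorProduct.tensorTensorTensorComm k M M N N (x c ⊗ₜ y c) := rfl

theorem recolor_single (D : Fin 2 → Ω) (c : Fin 3) (a b : M) :
    recolor D (Pi.single c (a ⊗ₜ[k] b) : Quad k M) =
      Pi.single c (Finsupp.single (D 0) a ⊗ₜ[k] Finsupp.single (D 1) b) := by
  funext d
  by_cases h : d = c
  · subst h; simp [recolor_apply]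
  · simp [recolor_apply, h]

/-- The Jacobi element acts as a unit for the shapewise product: all its coordinates are `1 ⊗ₜ 1`,
so after colouring it contributes only the colours. -/
theorem prodMap_recolor (D : Fin 2 → Ω) (x : Quad k M) :
    prodMap (recolor D (fun _ => 1 ⊗ₜ 1 : Quad k k)) x =
      map (colorEquiv k M Ω).toLinearMap (recolor D x) := by
  have h : prodMap (recolor D (fun _ => 1 ⊗ₜ 1 : Quad k k)) =
      map (colorEquiv k M Ω).toLinearMap ∘ₗ recolor D := by
    -- Here `c` is the shape of the tree with vertices `a` and `b`, and `d` is the coordinate being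
    -- compared; both sides vanish there unless `d = c`.
    ext c a b d : 6
    by_cases hd : d = c
    · subst hd; simp [map_apply, prodMap_apply, recolor_apply]
    · simp [map_apply, prodMap_apply, recolor_apply, hd]
  exact LinearMap.congr_fun h x

theorem prodMap_polarization [Fintype Ω] (c : Ω → ℕ) (x : Quad k M) :
    prodMap (polarization c (fun _ => 1 ⊗ₜ 1 : Quad k k)) x =
      map (colorEquiv k M Ω).toLinearMap (polarization c x) := by
  simp [polarization, prodMap_recolor]

/-- Both sides are suprema over the same types of colourings. Since the relations of `Lie` are
spanned by one element, `map₂` becomes an ordinary `map` for each type, and `prodMap_polarization`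
identifies the two maps. -/
theorem map_linRel [Fintype Ω] (S : Submodule k (Quad k M)) :
    (linRel Ω S).map (map (colorEquiv k M Ω).toLinearMap) =
      blackRel (linRel Ω (Submodule.span k {((fun _ => 1 ⊗ₜ 1) : Quad k k)})) S := by
  simp only [linRel, blackRel, Submodule.map_iSup, Submodule.map₂_iSup_left, Submodule.map_span,
    Set.image_singleton, Submodule.map₂_span_singleton_eq_map]
  refine iSup_congr fun c => iSup_congr fun _ => ?_
  rw [← Submodule.map_comp]
  exact congrArg (S.map ·) (LinearMap.ext fun x => (prodMap_polarization c x).symm)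

/-- The map that replaces all components of a tree polynomial by their sum. -/
noncomputable def sumConst : Quad k M →ₗ[k] Quad k M :=
  LinearMap.pi fun _ : Fin 3 => ∑ c : Fin 3, LinearMap.proj c

theorem sumConst_single (c : Fin 3) (t : M ⊗[k] M) :
    sumConst (Pi.single c t : Quad k M) = fun _ => t := by
  funext _
  rw [sumConst, LinearMap.pi_apply, LinearMap.sum_apply, Finset.sum_eq_single c]
  · simp
  · intro d _ hd
    simp [hd]
  · simp

theorem map_symm_mem_linRel [Fintype Ω] (S : Submodule k (Quad k M))
    {z : Quad k ((Ω →₀ k) ⊗[k] M)}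
    (hz : z ∈ blackRel (linRel Ω (Submodule.span k {((fun _ => 1 ⊗ₜ 1) : Quad k k)})) S) :
    map (colorEquiv k M Ω).symm.toLinearMap z ∈ linRel Ω S := by
  rw [← map_linRel] at hz
  obtain ⟨r, hr, rfl⟩ := hz
  rw [map_symm_map]
  exact hr

/-! ### The white product with `Com`, and a left inverse of Φ. -/

variable (k M Ω) in
/-- The map `T(k^Ω)(3) ⊗ T(M)(3) → T(M_Ω)(3)` that colours a tree polynomial over `M` by a coloured
tree, regardless of the labels of the leaves of the latter. -/
noncomputable def paint : Quad k (Ω →₀ k) ⊗[k] Quad k M →ₗ[k] Quad k (Ω →₀ M) :=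
  map (colorEquiv k M Ω).symm.toLinearMap ∘ₗ TensorProduct.lift
    (prodMap ∘ₗ sumConst (k := k) (M := Ω →₀ k))

/-- `sumConst` spreads a single coloured tree over all three shapes; the result is the coloured
Jacobi element, which acts by recolouring. Thus the answer does not depend on `c`. -/
theorem paint_recolor_single (D : Fin 2 → Ω) (c : Fin 3) (x : Quad k M) :
    paint k M Ω (recolor D (Pi.single c (1 ⊗ₜ 1) : Quad k k) ⊗ₜ[k] x) = recolor D x := by
  have h : sumConst (recolor D (Pi.single c (1 ⊗ₜ 1) : Quad k k)) =
      recolor D (fun _ => 1 ⊗ₜ 1 : Quad k k) := by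
    rw [recolor_single, sumConst_single]
    funext _
    simp [recolor_apply]
  rw [paint, LinearMap.comp_apply, TensorProduct.lift.tmul, LinearMap.comp_apply, h,
    prodMap_recolor, map_symm_map]

theorem paint_sub_tmul (a b : Quad k (Ω →₀ k)) (x : Quad k M) :
    paint k M Ω ((a - b) ⊗ₜ[k] x) = paint k M Ω (a ⊗ₜ[k] x) - paint k M Ω (b ⊗ₜ[k] x) :=
  map_sub (paint k M Ω ∘ₗ (TensorProduct.mk k (Quad k (Ω →₀ k)) (Quad k M)).flip x) a b

/-- Φ duplicates the shape: the first factor records it together with the colours, the second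
together with the original vertices. This is the formula by which white relations are tested. -/
theorem splitMap_map_recolor (D : Fin 2 → Ω) (x : Quad k M) :
    splitMap (map (colorEquiv k M Ω).toLinearMap (recolor D x)) =
      ∑ c : Fin 3, recolor D (Pi.single c (1 ⊗ₜ 1) : Quad k k) ⊗ₜ[k]
        (Pi.single c (x c) : Quad k M) := by
  have h : splitMap ∘ₗ map (colorEquiv k M Ω).toLinearMap ∘ₗ recolor D =
      ∑ c : Fin 3, TensorProduct.mk k _ _ (recolor D (Pi.single c (1 ⊗ₜ 1) : Quad k k)) ∘ₗ
        LinearMap.single k (fun _ : Fin 3 => M ⊗[k] M) c ∘ₗ LinearMap.proj c := by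
    ext c a b : 5
    simp only [LinearMap.comp_apply, LinearMap.sum_apply,
      TensorProduct.AlgebraTensorModule.curry_apply, LinearMap.restrictScalars_self,
      TensorProduct.curry_apply]
    rw [Finset.sum_eq_single c]
    · simp [recolor_single, map_single, splitMap_single]
    · intro d _ hd
      simp [hd]
    · simp
  simpa using LinearMap.congr_fun h x

/-- Coloured monomials span: a linear map on the free module in arity three is determined by its
values on trees whose two vertices each carry one colour. -/
theorem eq_top_of_recolor_mem {p : Submodule k (Quad k (Ω →₀ M))}
    (h : ∀ (D : Fin 2 → Ω) (c : Fin 3) (a b : M), recolor D (Pi.single c (a ⊗ₜ b)) ∈ p) :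
    p = ⊤ := by
  have : p.mkQ = 0 := by
    ext c i a j b : 7
    -- The colouring with `i` at the inner vertex and `j` at the root.
    have := h ![i, j] c a b
    rw [recolor_single] at this
    simpa using this
  rw [← p.ker_mkQ, this, LinearMap.ker_zero]

/-- Forgetting the shape in the first factor loses nothing, because Φ keeps it in the second. On a
coloured monomial the three painted terms sum back to that monomial. -/
theorem paint_splitMap_map (z : Quad k (Ω →₀ M)) :
    paint k M Ω (splitMap (map (colorEquiv k M Ω).toLinearMap z)) = z := by
  have h : LinearMap.eqLocus (paint k M Ω ∘ₗ splitMap ∘ₗ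
      map (colorEquiv k M Ω).toLinearMap) LinearMap.id = ⊤ := by
    refine eq_top_of_recolor_mem fun D c a b => ?_
    rw [LinearMap.mem_eqLocus, LinearMap.comp_apply, LinearMap.comp_apply, splitMap_map_recolor,
      map_sum]
    simp only [paint_recolor_single, ← map_sum, Finset.univ_sum_single, LinearMap.id_apply]
  exact LinearMap.congr_fun (LinearMap.eqLocus_eq_top.1 h) z

theorem recolor_mem_matRel {S : Submodule k (Quad k M)} (D : Fin 2 → Ω) {x : Quad k M}
    (hx : x ∈ S) : recolor D x ∈ matRel Ω S :=
  Submodule.mem_iSup_of_mem D ⟨x, hx, rfl⟩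

theorem recolor_sub_mem_permRel {D D' : Fin 2 → Ω} (h : colorType D = colorType D')
    (x : Quad k M) : recolor D x - recolor D' x ∈ permRel k M Ω :=
  Submodule.mem_iSup_of_mem D (Submodule.mem_iSup_of_mem D' (Submodule.mem_iSup_of_mem h ⟨x, rfl⟩))

variable (k) in
/-- The relations of the operad `Com`. -/
noncomputable def comRel : Submodule k (Quad k k) := (BinQuad.com k).R

theorem single_sub_single_mem_comRel (c d : Fin 3) :
    (Pi.single c (1 ⊗ₜ 1) - Pi.single d (1 ⊗ₜ 1) : Quad k k) ∈ comRel k := by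
  have h : ∀ c : Fin 3, (Pi.single (0 : Fin 3) (1 ⊗ₜ 1) - Pi.single c (1 ⊗ₜ 1) : Quad k k) ∈
      comRel k := by
    intro c
    fin_cases c
    · simp
    · exact Submodule.subset_span (Set.mem_insert _ _)
    · exact Submodule.subset_span (Set.mem_insert_of_mem _ rfl)
  simpa using sub_mem (h d) (h c)

/-- The relations of `Com` are spanned by differences of shapes, and painting ignores the shape. -/
theorem paint_recolor_of_mem_comRel (D : Fin 2 → Ω) {t : Quad k k} (ht : t ∈ comRel k)
    (x : Quad k M) : paint k M Ω (recolor D t ⊗ₜ[k] x) = 0 := by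
  obtain ⟨a, b, rfl⟩ := Submodule.mem_span_pair.1 ht
  rw [map_add, map_smul, map_smul, map_sub, map_sub, TensorProduct.add_tmul,
    ← TensorProduct.smul_tmul', ← TensorProduct.smul_tmul', map_add, map_smul, map_smul,
    paint_sub_tmul, paint_sub_tmul]
  simp only [paint_recolor_single, sub_self, smul_zero, add_zero]

theorem map_sub_eq_sum_sub_tmul {V A B ι : Type*} [AddCommGroup V] [AddCommGroup A]
    [AddCommGroup B] [Module k V] [Module k A] [Module k B] [Fintype ι] (F : V →ₗ[k] A ⊗[k] B)
    {x y : V} {u u' : ι → A} {s : ι → B} (hx : F x = ∑ c, u c ⊗ₜ s c)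
    (hy : F y = ∑ c, u' c ⊗ₜ s c) : F (x - y) = ∑ c, (u c - u' c) ⊗ₜ s c := by
  simp only [map_sub, hx, hy, TensorProduct.sub_tmul, Finset.sum_sub_distrib]

/-- Matching relations use both summands of the white relations: changing every shape to the shape 0
costs relations of `Com` in the first factor, and what remains has an element of `S` in the second.
Differences of colourings use the first summand only. -/
theorem map_mem_whiteRel (S : Submodule k (Quad k M)) {z : Quad k (Ω →₀ M)}
    (hz : z ∈ matRel Ω S ⊔ permRel k M Ω) :
    map (colorEquiv k M Ω).toLinearMap z ∈
      whiteRel (matRel Ω (comRel k) ⊔ permRel k k Ω) S := by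
  rw [← Submodule.mem_comap]
  refine (sup_le (iSup_le fun D => ?_) (iSup_le fun D => iSup_le fun D' => iSup_le fun hD => ?_) :
    matRel Ω S ⊔ permRel k M Ω ≤ _) hz
  · rintro _ ⟨x, hx, rfl⟩
    rw [Submodule.mem_comap, whiteRel, Submodule.mem_comap, splitMap_map_recolor]
    -- Subtract and add the shape 0 in each first factor; the added terms share that factor, so
    -- their second factors reassemble to `x`.
    have h : ∑ c : Fin 3, recolor D (Pi.single c (1 ⊗ₜ 1) : Quad k k) ⊗ₜ[k]
          (Pi.single c (x c) : Quad k M) =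
        ∑ c : Fin 3, recolor D
          (Pi.single c (1 ⊗ₜ 1) - Pi.single (0 : Fin 3) (1 ⊗ₜ 1) : Quad k k) ⊗ₜ[k]
            (Pi.single c (x c) : Quad k M) +
        recolor D (Pi.single (0 : Fin 3) (1 ⊗ₜ 1) : Quad k k) ⊗ₜ[k] x := by
      have h' := TensorProduct.tmul_sum (R := k)
        (recolor D (Pi.single (0 : Fin 3) (1 ⊗ₜ 1) : Quad k k)) Finset.univ
        fun c : Fin 3 => (Pi.single c (x c) : Quad k M)
      rw [Finset.univ_sum_single] at h'
      rw [h', ← Finset.sum_add_distrib]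
      refine Finset.sum_congr rfl fun c _ => ?_
      rw [← TensorProduct.add_tmul, ← map_add, sub_add_cancel]
    rw [h]
    exact add_mem (Submodule.mem_sup_left (sum_mem fun c _ => Submodule.apply_mem_map₂ _
        (Submodule.mem_sup_left (recolor_mem_matRel D (single_sub_single_mem_comRel c 0)))
        trivial))
      (Submodule.mem_sup_right (Submodule.apply_mem_map₂ _ trivial hx))
  · rintro _ ⟨x, rfl⟩
    have h := map_sub_eq_sum_sub_tmul (splitMap ∘ₗ map (colorEquiv k M Ω).toLinearMap)
      (splitMap_map_recolor D x) (splitMap_map_recolor D' x)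
    rw [Submodule.mem_comap, whiteRel, Submodule.mem_comap]
    refine (congrArg (· ∈ _) h).mpr ?_
    exact Submodule.mem_sup_left (sum_mem fun c _ => Submodule.apply_mem_map₂ _
      (Submodule.mem_sup_right (recolor_sub_mem_permRel hD _)) trivial)

theorem single_tmul_eq_smul (c : Fin 3) (a b : k) :
    (Pi.single c (a ⊗ₜ b) : Quad k k) = (a * b) • (Pi.single c (1 ⊗ₜ 1) : Quad k k) := by
  rw [← Pi.single_smul, mul_smul, ← TensorProduct.tmul_smul, TensorProduct.smul_tmul',
    smul_eq_mul, smul_eq_mul, mul_one, mul_one]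

/-- Painting turns a difference of two colourings of one tree into the difference of the same two
colourings of `x`. -/
theorem paint_mem_permRel {D D' : Fin 2 → Ω} (h : colorType D = colorType D')
    (t : Quad k k) (x : Quad k M) :
    paint k M Ω ((recolor D t - recolor D' t) ⊗ₜ[k] x) ∈ permRel k M Ω := by
  have h' : (permRel k M Ω).mkQ ∘ₗ paint k M Ω ∘ₗ (TensorProduct.mk k _ _).flip x ∘ₗ
      (recolor D - recolor D') = 0 := by
    -- As `k ⊗ k` is generated by `1 ⊗ₜ 1`, it suffices to treat the single tree of each shape `c`.
    ext c : 4
    simp only [LinearMap.comp_apply, LinearMap.sub_apply, LinearMap.flip_apply,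
      TensorProduct.mk_apply, TensorProduct.AlgebraTensorModule.curry_apply,
      LinearMap.restrictScalars_self, TensorProduct.curry_apply, LinearMap.coe_single]
    rw [paint_sub_tmul, paint_recolor_single, paint_recolor_single]
    exact (Submodule.Quotient.mk_eq_zero _).2 (recolor_sub_mem_permRel h x)
  simpa using LinearMap.congr_fun h' t

/-- An arbitrary first factor is a linear combination of coloured trees, each of which paints `x`
with one colouring, giving a matching relation. -/
theorem paint_mem_matRel (S : Submodule k (Quad k M)) (a : Quad k (Ω →₀ k))
    {x : Quad k M} (hx : x ∈ S) : paint k M Ω (a ⊗ₜ[k] x) ∈ matRel Ω S := by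
  have h : (matRel Ω S).comap (paint k M Ω ∘ₗ (TensorProduct.mk k _ _).flip x) = ⊤ := by
    refine eq_top_of_recolor_mem fun D c α β => ?_
    rw [single_tmul_eq_smul, map_smul]
    refine Submodule.smul_mem _ _ ?_
    simpa [paint_recolor_single] using recolor_mem_matRel D hx
  have ha : a ∈ (⊤ : Submodule k (Quad k (Ω →₀ k))) := trivial
  rw [← h] at ha
  exact ha

/-- It suffices that `paint` carries both summands defining the white relations into the target:
applied to `splitMap z`, it returns the element in question. -/
theorem map_symm_mem_matRel_sup_permRel (S : Submodule k (Quad k M))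
    {z : Quad k ((Ω →₀ k) ⊗[k] M)}
    (hz : z ∈ whiteRel (matRel Ω (comRel k) ⊔ permRel k k Ω) S) :
    map (colorEquiv k M Ω).symm.toLinearMap z ∈ matRel Ω S ⊔ permRel k M Ω := by
  have hperm : ∀ x : Quad k M, matRel Ω (comRel k) ⊔ permRel k k Ω ≤
      (matRel Ω S ⊔ permRel k M Ω).comap
        (paint k M Ω ∘ₗ (TensorProduct.mk k (Quad k (Ω →₀ k)) (Quad k M)).flip x) := by
    intro x
    refine sup_le (iSup_le fun D => ?_)
      (iSup_le fun D => iSup_le fun D' => iSup_le fun hD => ?_)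
    · rintro _ ⟨t, ht, rfl⟩
      have h0 := paint_recolor_of_mem_comRel D ht x
      exact Submodule.mem_comap.2 (h0.symm ▸ zero_mem (matRel Ω S ⊔ permRel k M Ω))
    · rintro _ ⟨t, rfl⟩
      exact Submodule.mem_sup_right (paint_mem_permRel hD t x)
  have h : Submodule.map₂ (TensorProduct.mk k (Quad k (Ω →₀ k)) (Quad k M))
        (matRel Ω (comRel k) ⊔ permRel k k Ω) ⊤ ⊔
      Submodule.map₂ (TensorProduct.mk k (Quad k (Ω →₀ k)) (Quad k M)) ⊤ S ≤
      (matRel Ω S ⊔ permRel k M Ω).comap (paint k M Ω) :=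
    sup_le (Submodule.map₂_le.2 fun a ha x _ => hperm x ha)
      (Submodule.map₂_le.2 fun a _ x hx => Submodule.mem_sup_left (paint_mem_matRel S a hx))
  -- The element is rewritten as `paint` of `splitMap z`, and `hz` says precisely that `splitMap z`
  -- lies in the sum treated by `h`.
  have h' := paint_splitMap_map (map (colorEquiv k M Ω).symm.toLinearMap z)
  rw [map_map_symm] at h'
  rw [← h']
  exact h hz

end Quad

theorem mainTheorem3 {k : Type u} [Field k] [CharZero k] {Ω : Type w} [Fintype Ω] [Nonempty Ω]
    (P : BinQuad.{u, v} k) [Module.Finite k P.M] :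
    Nonempty ((P.lin Ω).operad.Iso (((BinQuad.lie k).lin Ω).black P).operad) ∧
      Nonempty ((P.tot Ω).operad.Iso (((BinQuad.com k).tot Ω).white P).operad) := by
  exact ⟨BinQuad.nonempty_iso _ _ (Quad.colorEquiv k P.M Ω)
      (Quad.colorEquiv_finsupp_signTwist P.rep)
      (fun r hr => (Quad.map_linRel P.R).le ⟨r, hr, rfl⟩)
      (fun s hs => Quad.map_symm_mem_linRel P.R hs),
    BinQuad.nonempty_iso _ _ (Quad.colorEquiv k P.M Ω) (Quad.colorEquiv_finsupp P.rep)
      (fun r hr => Quad.map_mem_whiteRel P.R hr)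
      (fun s hs => Quad.map_symm_mem_matRel_sup_permRel P.R hs)⟩
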